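/- Let the base stations form a homogeneous Poisson point process of intensity $\lambda>0$ in the plane, and consider a user at the origin served by its closest base station, at distance $r$. Let $P>0$ be the transmit power, $\sigma^2\ge 0$ the noise power, $\alpha>2$ the path loss exponent, $\Delta\ge 1$ an integer (the number of edge sub-bands) and $T_{FR}>0$ the reuse threshold. Each base station $z$ at distance $R_z$ from the user carries two fading variables $g_z,\hat g_z$, exponentially distributed with rate $\mu>0$ (mean $1/\mu$), and a sub-band $\delta_z$ uniform in $\{1,\dots,\Delta\}$; all these marks are independent of each other and of the locations. Write $y$ for the serving base station and put $$I_r=\sum_{z\ne y} g_zR_z^{-\alpha},\qquad \hat I_r=\sum_{z\neq y,\ \delta_z=\delta_y}\hat g_zR_z^{-\alpha}.$$ The user is an edge user if its SINR on the common sub-band is below the threshold, i.e. $\frac{Pg_yr^{-\alpha}}{\sigma^2+PI_r}<T_{FR}$; on the edge sub-band then assigned to it, its SINR is $\mathrm{SINR}=\frac{P\hat g_yr^{-\alpha}}{\sigma^2+P\hat I_r}$. For $T>0$ define $$\rho(T,\alpha)=T^{2/\alpha}\int_{T^{-2/\alpha}}^\infty\frac{du}{1+u^{\alpha/2}},\qquad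 p_c(T,\lambda,\alpha,\Delta)=\pi\lambda\int_0^\infty e^{-\pi\lambda v\left(1+\frac1\Delta\rho(T,\alpha)\right)-\mu T\frac{\sigma^2}{P}v^{\alpha/2}}\,dv,$$ $$\xi(T,T_{FR},\alpha,\Delta)=\int_1^\infty\left[1-\frac{1}{1+T_{FR}x^{-\alpha}}\left(1-\frac1\Delta\left(1-\frac{1}{1+Tx^{-\alpha}}\right)\right)\right]x\,dx,$$ $$q(T,T_{FR},\lambda,\alpha,\Delta)=\pi\lambda\int_0^\infty e^{-\pi\lambda v\left(1+2\xi(T,T_{FR},\alpha,\Delta)\right)-\mu(T+T_{FR})\frac{\sigma^2}{P}v^{\alpha/2}}\,dv.$$ Then almost surely a closest base station exists, both interference sums converge and both SINR denominators are positive; the user is an edge user with positive probability, and $1-p_c(T_{FR},\lambda,\alpha,1)>0$. Moreover the average rate of an edge user under Strict FFR, i.e. the conditional expectation of $\ln(1+\mathrm{SINR})$ given that the user is an edge user, is finite, the integral on the right below converges absolutely, and $$\mathbb E\left[\ln(1+\mathrm{SINR})\,\middle|\,\frac{Pg_yr^{-\alpha}}{\sigma^2+PI_r}<T_{FR}\right]=\int_{t>0}\frac{p_c(e^t-1,\lambda,\alpha,\Delta)-q(e^t-1,T_{FR},\lambda,\alpha,\Delta)}{1-p_c(T_{FR},\lambda,\alpha,1)}\,dt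 .$$ -/

import Mathlib

open MeasureTheory ProbabilityTheory

namespace StrictFFR

noncomputable section

/-- The plane of base station and user locations. -/
abbrev Plane : Type := EuclideanSpace ℝ (Fin 2)

section Model

variable {Ω : Type*} [MeasurableSpace Ω]

/-- Number of points of the configuration `(X n ω)ₙ` in the set `B`, with multiplicity. -/
def pointCount (X : ℕ → Ω → Plane) (B : Set Plane) (ω : Ω) : ℕ∞ :=
  {n : ℕ | X n ω ∈ B}.encard

/-- The points `(X n)ₙ` form a homogeneous Poisson point process in the plane with intensity `lam`:
the number of points in a measurable set of finite area is Poisson distributed with mean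
`lam * area`, and the numbers of points in disjoint measurable sets are independent. Such a
process has infinitely many points almost surely, so its points can be listed by `ℕ`. -/
structure IsPoissonProcess (Pr : Measure Ω) (lam : ℝ) (X : ℕ → Ω → Plane) : Prop where
  measurable : ∀ n, Measurable (X n)
  hasLaw_pointCount : ∀ B : Set Plane, MeasurableSet B → volume B ≠ ⊤ →
    HasLaw (pointCount X B)
      ((poissonMeasure (lam * (volume B).toReal).toNNReal).map (fun k : ℕ => (k : ℕ∞))) Pr
  iIndepFun_pointCount : ∀ (k : ℕ) (B : Fin k → Set Plane), (∀ i, MeasurableSet (B i)) →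
    (∀ i j, i ≠ j → Disjoint (B i) (B j)) → iIndepFun (fun i => pointCount X (B i)) Pr

/-- The probabilistic model of the network, seen by a typical user at the origin. The base stations
`X n` form a Poisson process of intensity `lam`. Base station `n` carries the marks
* `g n`: its fading to the user on the common sub-band,
* `g' n`: its fading to the user on the newly assigned sub-band,
* `δ n`: the sub-band, out of `Δ`, reserved for the edge users of its cell.

All these marks are independent of each other and of the locations; the fadings are exponential
with rate `mu` (mean `1 / mu`) and the sub-bands are uniform. -/
structure IsNetwork (Pr : Measure Ω) (lam mu : ℝ) (Δ : ℕ)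
    (X : ℕ → Ω → Plane) (g g' : ℕ → Ω → ℝ) (δ : ℕ → Ω → Fin Δ) : Prop where
  poisson : IsPoissonProcess Pr lam X
  measurable_fading : ∀ n, Measurable (g n)
  measurable_fading' : ∀ n, Measurable (g' n)
  measurable_band : ∀ n, Measurable (δ n)
  hasLaw_marks : ∀ n, HasLaw (fun ω => (g n ω, g' n ω, δ n ω))
    ((expMeasure mu).prod ((expMeasure mu).prod (uniformOn (Set.univ : Set (Fin Δ))))) Pr
  iIndepFun_marks : iIndepFun (fun n ω => (g n ω, g' n ω, δ n ω)) Pr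
  indepFun_marks : IndepFun (fun ω n => X n ω) (fun ω n => (g n ω, g' n ω, δ n ω)) Pr

/-- The indices of the base stations closest to the user at the origin (almost surely exactly
one index). -/
def nearest (X : ℕ → Ω → Plane) (ω : Ω) : Set ℕ :=
  {n | ∀ m, ‖X n ω‖ ≤ ‖X m ω‖}

/-- The index of the serving base station, i.e. of the one closest to the user. -/
def serving (X : ℕ → Ω → Plane) (ω : Ω) : ℕ := sInf (nearest X ω)

/-- On the common sub-band all base stations but the serving one interfere. -/
def commonInterferers (X : ℕ → Ω → Plane) (ω : Ω) : Set ℕ :=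
  {n | n ≠ serving X ω}

/-- On the edge sub-band of the serving cell, only those base stations interfere that use the same
sub-band for their edge users. -/
def edgeInterferers {Δ : ℕ} (X : ℕ → Ω → Plane) (δ : ℕ → Ω → Fin Δ) (ω : Ω) : Set ℕ :=
  {n | n ≠ serving X ω ∧ δ n ω = δ (serving X ω) ω}

/-- The contribution `g_z R_z ^ (-α)` of base station `n` to the interference from the set `Z` of
base stations. -/
def interferenceTerm (α : ℝ) (X : ℕ → Ω → Plane) (h : ℕ → Ω → ℝ) (Z : Ω → Set ℕ)
    (ω : Ω) (n : ℕ) : ℝ :=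
  (Z ω).indicator (fun n => h n ω * ‖X n ω‖ ^ (-α)) n

/-- The interference `I_r = ∑ g_z R_z ^ (-α)` from the set `Z` of base stations. -/
def interference (α : ℝ) (X : ℕ → Ω → Plane) (h : ℕ → Ω → ℝ) (Z : Ω → Set ℕ) (ω : Ω) : ℝ :=
  ∑' n, interferenceTerm α X h Z ω n

/-- The signal to interference plus noise ratio `P h r ^ (-α) / (σ² + P I_r)` under the fadings `h`
and the set `Z` of interfering base stations, where `r` is the distance to the serving one. -/
def sinr (P σ α : ℝ) (X : ℕ → Ω → Plane) (h : ℕ → Ω → ℝ) (Z : Ω → Set ℕ) (ω : Ω) : ℝ :=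
  P * h (serving X ω) ω * ‖X (serving X ω) ω‖ ^ (-α) / (σ ^ 2 + P * interference α X h Z ω)

/-- The event that the user is an edge user: its SINR on the common sub-band is below `T_FR`. -/
def edgeEvent (P σ α TFR : ℝ) (X : ℕ → Ω → Plane) (g : ℕ → Ω → ℝ) : Set Ω :=
  {ω | sinr P σ α X g (commonInterferers X) ω < TFR}

/-- The rate `ln (1 + SINR)` (nats/Hz) of the user on the edge sub-band of its cell. -/
def edgeRate (P σ α : ℝ) {Δ : ℕ} (X : ℕ → Ω → Plane) (g' : ℕ → Ω → ℝ) (δ : ℕ → Ω → Fin Δ)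
    (ω : Ω) : ℝ :=
  Real.log (1 + sinr P σ α X g' (edgeInterferers X δ) ω)

end Model

/-- `ρ(T, α) = T ^ (2/α) ∫_{T ^ (-2/α)}^∞ du / (1 + u ^ (α/2))`. -/
def rho (T α : ℝ) : ℝ :=
  T ^ (2 / α) * ∫ u in Set.Ioi (T ^ (-2 / α)), 1 / (1 + u ^ (α / 2))

/-- The coverage probability expression `p_c(T, λ, α, Δ)` of reuse-`Δ`. -/
def pc (P σ mu T lam α : ℝ) (Δ : ℕ) : ℝ :=
  Real.pi * lam * ∫ v in Set.Ioi (0 : ℝ),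
    Real.exp (-Real.pi * lam * v * (1 + 1 / (Δ : ℝ) * rho T α)
      - mu * T * (σ ^ 2 / P) * v ^ (α / 2))

/-- `ξ(T, T_FR, α, Δ)`. -/
def xi (T TFR α : ℝ) (Δ : ℕ) : ℝ :=
  ∫ x in Set.Ioi (1 : ℝ),
    (1 - 1 / (1 + TFR * x ^ (-α)) *
      (1 - 1 / (Δ : ℝ) * (1 - 1 / (1 + T * x ^ (-α))))) * x

/-- `π λ ∫_0^∞ exp (-π λ v (1 + 2 ξ(T, T_FR, α, Δ)) - μ (T + T_FR) (σ²/P) v ^ (α/2)) dv`. -/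
def qc (P σ mu T TFR lam α : ℝ) (Δ : ℕ) : ℝ :=
  Real.pi * lam * ∫ v in Set.Ioi (0 : ℝ),
    Real.exp (-Real.pi * lam * v * (1 + 2 * xi T TFR α Δ)
      - mu * (T + TFR) * (σ ^ 2 / P) * v ^ (α / 2))

/-- The integrand of the average rate formula. -/
def rateIntegrand (P σ mu TFR lam α : ℝ) (Δ : ℕ) (t : ℝ) : ℝ :=
  (pc P σ mu (Real.exp t - 1) lam α Δ - qc P σ mu (Real.exp t - 1) TFR lam α Δ) /
    (1 - pc P σ mu TFR lam α 1)

end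

end StrictFFR

/-! The core is the joint tail of the two SINRs: for thresholds `a, b ≥ 0` on the common and the
edge sub-band, both are met with probability `qc` at `(b, a)` (`IsNetwork.measure_coveredEvent`,
`IsNetwork.measure_le_sinr`). Freeze the locations. Coverage says that the two exponential fadings
of the serving station exceed thresholds that are linear in the marks of the others, so its
probability is a Laplace transform. Independence splits this into one `interfererFactor` per
interferer, the `1 / Δ` being the chance of sharing the sub-band (`measure_covered_of_marks`).

Averaging over the locations uses the Poisson Laplace functional and the law of the closest point:
`v = r ^ 2` is exponential with rate `π λ`, and given `v` the other points form a Poisson process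
outside the disc (`IsPoissonProcess.lintegral_nearest`). Polar coordinates turn the remaining plane
integral into `2 π v ξ`.

A zero threshold switches a sub-band off, and `2 ξ` then becomes `ρ / Δ` or `ρ`; so both `p_c` terms
are marginals of the joint tail. Subtracting the part with common SINR at least `T_FR` gives the
edge tail on the edge event, and the layer cake formula with `ln (1 + S) ≥ t ↔ S ≥ e ^ t - 1` gives
the rate. Integrability holds because `ξ` grows at least like `T ^ (2 / α)`, so the tail is `O(e ^
(-2 t / α))`.

Coverage is phrased in `[0, ∞]`, where every sum makes sense, so its probability is known before any
convergence. The noiseless case then shows that the interference sums are almost surely finite and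
nonzero (`ae_ne_zero_and_ne_top_of_tail`), which makes the real-valued SINRs meaningful even for `σ
= 0`. -/

namespace StrictFFR

open Filter Topology ENNReal

/-! ### The exponential on `[0, ∞]` and convergence from below. -/

/-- The function `x ↦ exp (-x)` on `[0, ∞]`, with `exp (-∞) = 0`. -/
noncomputable def negExp (x : ℝ≥0∞) : ℝ≥0∞ := (EReal.exp (x : EReal))⁻¹

@[simp] lemma negExp_zero : negExp 0 = 1 := by simp [negExp]

@[simp] lemma negExp_top : negExp ⊤ = 0 := by simp [negExp]

lemma negExp_add (x y : ℝ≥0∞) : negExp (x + y) = negExp x * negExp y := by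
  rw [negExp, EReal.coe_ennreal_add, EReal.exp_add, ENNReal.mul_inv]
  · rfl
  · left; simp
  · right; simp

lemma negExp_sum {ι : Type*} (s : Finset ι) (f : ι → ℝ≥0∞) :
    negExp (∑ i ∈ s, f i) = ∏ i ∈ s, negExp (f i) := by
  classical
  induction s using Finset.induction_on with
  | empty => simp
  | insert a s ha ih => rw [Finset.sum_insert ha, Finset.prod_insert ha, negExp_add, ih]

lemma continuous_negExp : Continuous negExp :=
  continuous_inv.comp (ENNReal.continuous_exp.comp continuous_coe_ennreal_ereal)

@[fun_prop] lemma measurable_negExp : Measurable negExp := continuous_negExp.measurable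

lemma negExp_antitone : Antitone negExp := fun x y h => by
  unfold negExp
  exact ENNReal.inv_le_inv.2 (EReal.exp_monotone (by exact_mod_cast h))

lemma negExp_le_one (x : ℝ≥0∞) : negExp x ≤ 1 := by
  simpa using negExp_antitone (zero_le (a := x))

lemma negExp_ne_top (x : ℝ≥0∞) : negExp x ≠ ⊤ :=
  ((negExp_le_one x).trans_lt one_lt_top).ne

lemma negExp_ofReal {x : ℝ} (hx : 0 ≤ x) : negExp (ENNReal.ofReal x) = ENNReal.ofReal (Real.exp (-x)) := by
  rw [negExp, EReal.coe_ennreal_ofReal, max_eq_left hx, EReal.exp_coe, Real.exp_neg,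
    ENNReal.ofReal_inv_of_pos (Real.exp_pos x)]

lemma measurable_one_sub_negExp {α : Type*} [MeasurableSpace α] {f : α → ℝ≥0∞}
    (hf : Measurable f) : Measurable fun x => 1 - negExp (f x) :=
  (measurable_const.sub (measurable_negExp.comp hf))

lemma continuous_one_sub_negExp : Continuous fun x => 1 - negExp x :=
  (ENNReal.continuous_sub_left one_ne_top).comp continuous_negExp

/-- Convergence of integrals of functions that converge from below. -/
lemma tendsto_lintegral_of_le {α : Type*} [MeasurableSpace α] {μ : Measure α}
    {F : ℕ → α → ℝ≥0∞} {f : α → ℝ≥0∞} (hF : ∀ n, Measurable (F n)) (hle : ∀ n x, F n x ≤ f x)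
    (hlim : ∀ᵐ x ∂μ, Tendsto (fun n => F n x) atTop (𝓝 (f x))) :
    Tendsto (fun n => ∫⁻ x, F n x ∂μ) atTop (𝓝 (∫⁻ x, f x ∂μ)) := by
  -- Fatou bounds the integral of `f` by the liminf, and `F n ≤ f` bounds the limsup; neither
  -- monotonicity in `n` nor finiteness is needed.
  refine tendsto_of_le_liminf_of_limsup_le ?_ ?_
  · calc ∫⁻ x, f x ∂μ = ∫⁻ x, liminf (fun n => F n x) atTop ∂μ :=
        lintegral_congr_ae (hlim.mono fun x hx => hx.liminf_eq.symm)
      _ ≤ _ := lintegral_liminf_le hF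
  · refine limsup_le_of_le (by isBoundedDefault) (Eventually.of_forall fun n => ?_)
    exact lintegral_mono fun x => hle n x

lemma tendsto_tsum_of_le {ι : Type*} {F : ℕ → ι → ℝ≥0∞} {f : ι → ℝ≥0∞}
    (hle : ∀ n i, F n i ≤ f i) (hlim : ∀ i, Tendsto (fun n => F n i) atTop (𝓝 (f i))) :
    Tendsto (fun n => ∑' i, F n i) atTop (𝓝 (∑' i, f i)) := by
  let _ : MeasurableSpace ι := ⊤
  simpa only [lintegral_count] using tendsto_lintegral_of_le (μ := Measure.count)
    (fun n => measurable_from_top) hle (Eventually.of_forall hlim)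

/-! ### The Laplace functional of the Poisson process. -/

lemma lintegral_negExp_poissonMeasure (x : NNReal) {c : ℝ≥0∞} (hc : c ≠ ⊤) :
    ∫⁻ k, negExp (c * (k : ℝ≥0∞)) ∂(poissonMeasure x) = negExp (x * (1 - negExp c)) := by
  lift c to NNReal using hc
  have hexp : ∀ y : NNReal, negExp y = ENNReal.ofReal (Real.exp (-(y : ℝ))) := fun y => by
    rw [← ENNReal.ofReal_coe_nnreal, negExp_ofReal y.coe_nonneg]
  rw [lintegral_countable']
  have h1 : ∀ k : ℕ, negExp (c * (k : ℝ≥0∞)) * (poissonMeasure x) {k}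
      = ENNReal.ofReal (Real.exp (-x) * ((x * Real.exp (-c)) ^ k / k.factorial)) := by
    intro k
    rw [poissonMeasure_singleton]
    have : (c * (k : ℝ≥0∞)) = ((c * k : NNReal) : ℝ≥0∞) := by push_cast; rfl
    rw [this, hexp, ← ENNReal.ofReal_mul (Real.exp_pos _).le]
    congr 1
    have : Real.exp (-((c * k : NNReal) : ℝ)) = Real.exp (-c) ^ k := by
      rw [← Real.exp_nat_mul]; congr 1; push_cast; ring
    rw [this, mul_pow]; ring
  simp_rw [h1]
  have hs := (NormedSpace.expSeries_div_hasSum_exp (𝔸 := ℝ) (x * Real.exp (-(c : ℝ)))).mul_left (Real.exp (-x))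
  rw [← ENNReal.ofReal_tsum_of_nonneg (fun k => by positivity) hs.summable, hs.tsum_eq,
    ← congrFun Real.exp_eq_exp_ℝ, ← Real.exp_add, hexp]
  have h2 : (1 : ℝ≥0∞) - ENNReal.ofReal (Real.exp (-(c : ℝ))) = ENNReal.ofReal (1 - Real.exp (-c)) := by
    rw [ENNReal.ofReal_sub _ (Real.exp_pos _).le, ENNReal.ofReal_one]
  have h3 : 0 ≤ 1 - Real.exp (-(c : ℝ)) := by
    have : Real.exp (-(c : ℝ)) ≤ 1 := Real.exp_le_one_iff.2 (by simp)
    linarith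
  rw [h2, ← ENNReal.ofReal_coe_nnreal, ← ENNReal.ofReal_mul x.coe_nonneg, negExp_ofReal (by positivity)]
  congr 2
  ring

/-- A sum over points makes counts measurable and lets sums of simple functions over the process be
regrouped into counts. -/
lemma toENNReal_pointCount {Ω : Type*} (X : ℕ → Ω → Plane) (B : Set Plane) (ω : Ω) :
    (pointCount X B ω : ℝ≥0∞) = ∑' n, B.indicator (fun _ => (1 : ℝ≥0∞)) (X n ω) := by
  rw [pointCount, ← ENNReal.tsum_set_one, tsum_subtype {n | X n ω ∈ B} (fun _ => (1 : ℝ≥0∞))]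
  rfl

section Poisson

variable {Ω : Type*} [MeasurableSpace Ω] {Pr : Measure Ω} {lam : ℝ} {X : ℕ → Ω → Plane}

lemma IsPoissonProcess.measurable_pointCount (h : IsPoissonProcess Pr lam X) {B : Set Plane}
    (hB : MeasurableSet B) : Measurable (pointCount X B) := by
  have h1 : Measurable fun ω => (pointCount X B ω : ℝ≥0∞) := by
    simp_rw [toENNReal_pointCount]
    exact Measurable.tsum fun n => (measurable_const.indicator hB).comp (h.measurable n)
  rw [ENat.measurable_iff]
  intro n
  convert h1 (measurableSet_singleton (n : ℝ≥0∞)) using 1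
  ext ω
  simp only [Set.mem_preimage, Set.mem_singleton_iff]
  rw [← ENat.toENNReal_coe, ENat.toENNReal_inj]

lemma IsPoissonProcess.lintegral_negExp_pointCount (h : IsPoissonProcess Pr lam X) (hlam : 0 ≤ lam)
    {B : Set Plane} (hB : MeasurableSet B) (hfin : volume B ≠ ⊤) {c : ℝ≥0∞} (hc : c ≠ ⊤) :
    ∫⁻ ω, negExp (c * (pointCount X B ω : ℝ≥0∞)) ∂Pr
      = negExp (ENNReal.ofReal lam * (volume B * (1 - negExp c))) := by
  rw [(h.hasLaw_pointCount B hB hfin).lintegral_comp (f := fun k : ℕ∞ => negExp (c * (k : ℝ≥0∞)))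
    (Measurable.of_discrete.aemeasurable), lintegral_map Measurable.of_discrete Measurable.of_discrete]
  simp only [ENat.toENNReal_coe]
  rw [lintegral_negExp_poissonMeasure _ hc]
  congr 1
  rw [← mul_assoc]
  congr 1
  change ENNReal.ofReal _ = _
  rw [ENNReal.ofReal_mul hlam, ENNReal.ofReal_toReal hfin]

/-- The level sets of `φ` are disjoint, so the sum over the points is a finite linear combination of
independent Poisson counts, and the expectation factorizes. -/
lemma IsPoissonProcess.lintegral_negExp_simpleFunc (h : IsPoissonProcess Pr lam X) (hlam : 0 ≤ lam)
    (φ : SimpleFunc Plane ℝ≥0∞) (hφ : ∀ y, φ y ≠ ⊤) (hfin : volume {y | φ y ≠ 0} ≠ ⊤) :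
    ∫⁻ ω, negExp (∑' n, φ (X n ω)) ∂Pr
      = negExp (ENNReal.ofReal lam * ∫⁻ y, (1 - negExp (φ y))) := by
  classical
  -- The value `0` is left out because its level set has infinite area.
  set S : Finset ℝ≥0∞ := φ.range.filter (· ≠ 0) with hS
  let e := S.equivFin
  let B : Fin S.card → Set Plane := fun i => φ ⁻¹' {(e.symm i : ℝ≥0∞)}
  have hBm : ∀ i, MeasurableSet (B i) := fun i => φ.measurableSet_fiber _
  have hne : ∀ i, (e.symm i : ℝ≥0∞) ≠ 0 := fun i => (Finset.mem_filter.1 (e.symm i).2).2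
  have hnt : ∀ i, (e.symm i : ℝ≥0∞) ≠ ⊤ := fun i => by
    obtain ⟨y, hy⟩ := SimpleFunc.mem_range.1 (Finset.mem_filter.1 (e.symm i).2).1
    rw [← hy]; exact hφ y
  have hBfin : ∀ i, volume (B i) ≠ ⊤ := fun i =>
    ((measure_mono fun y (hy : φ y = _) => by
      change φ y ≠ 0; rw [hy]; exact hne i).trans_lt hfin.lt_top).ne
  have hBd : ∀ i j, i ≠ j → Disjoint (B i) (B j) := fun i j hij =>
    Disjoint.preimage _ (Set.disjoint_singleton.2 fun hh => hij (e.symm.injective (Subtype.ext hh)))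
  -- Used with `G = id` for the sum over the points and with `G = 1 - negExp` for the intensity
  -- integral.
  have key : ∀ (G : ℝ≥0∞ → ℝ≥0∞), G 0 = 0 → ∀ y,
      G (φ y) = ∑ i, G (e.symm i) * (B i).indicator (fun _ => (1 : ℝ≥0∞)) y := by
    intro G hG y
    by_cases hy : φ y = 0
    · rw [hy, hG]; symm
      refine Finset.sum_eq_zero fun i _ => ?_
      rw [Set.indicator_of_notMem, mul_zero]
      intro hi
      exact hne i (by rw [← show φ y = _ from hi, hy])
    · have hyS : φ y ∈ S := Finset.mem_filter.2 ⟨SimpleFunc.mem_range_self φ y, hy⟩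
      rw [Finset.sum_eq_single (e ⟨φ y, hyS⟩)]
      · rw [Set.indicator_of_mem, mul_one]
        · simp
        · simp [B]
      · intro j _ hj
        rw [Set.indicator_of_notMem, mul_zero]
        intro hi
        apply hj
        have : φ y = _ := hi
        rw [← e.symm_apply_eq]
        exact Subtype.ext this.symm
      · simp
  have hsum : ∀ ω, ∑' n, φ (X n ω) = ∑ i, (e.symm i : ℝ≥0∞) * (pointCount X (B i) ω : ℝ≥0∞) := by
    intro ω
    simp_rw [toENNReal_pointCount]
    rw [show (∑' n, φ (X n ω)) = ∑' n, ∑ i, (e.symm i : ℝ≥0∞) *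
      (B i).indicator (fun _ => (1 : ℝ≥0∞)) (X n ω) from tsum_congr fun n => key id rfl _]
    rw [Summable.tsum_finsetSum fun _ _ => ENNReal.summable]
    exact Finset.sum_congr rfl fun i _ => ENNReal.tsum_mul_left
  have hint : ∫⁻ y, (1 - negExp (φ y)) = ∑ i, volume (B i) * (1 - negExp (e.symm i)) := by
    rw [lintegral_congr (key (fun x => 1 - negExp x) (by simp))]
    rw [lintegral_finsetSum _ fun i _ => (measurable_const.indicator (hBm i)).const_mul _]
    refine Finset.sum_congr rfl fun i _ => ?_
    rw [lintegral_const_mul _ (measurable_const.indicator (hBm i)), lintegral_indicator (hBm i),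
      setLIntegral_one, mul_comm]
  rw [hint, Finset.mul_sum, negExp_sum, lintegral_congr fun ω => by rw [hsum ω, negExp_sum]]
  have hind : iIndepFun (fun i ω => negExp ((e.symm i : ℝ≥0∞) * (pointCount X (B i) ω : ℝ≥0∞))) Pr :=
    (h.iIndepFun_pointCount _ B hBm hBd).comp
      (fun i (k : ℕ∞) => negExp ((e.symm i : ℝ≥0∞) * (k : ℝ≥0∞))) fun i => Measurable.of_discrete
  rw [lintegral_prod_eq_prod_lintegral_of_indepFun _ _ hind fun i =>
    (Measurable.of_discrete (f := fun k : ℕ∞ => negExp ((e.symm i : ℝ≥0∞) * (k : ℝ≥0∞)))).comp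
      (h.measurable_pointCount (hBm i))]
  exact Finset.prod_congr rfl fun i _ => h.lintegral_negExp_pointCount hlam (hBm i) (hBfin i) (hnt i)

/-- The Laplace functional of a homogeneous Poisson process. -/
theorem IsPoissonProcess.lintegral_negExp_tsum (h : IsPoissonProcess Pr lam X) (hlam : 0 ≤ lam)
    [IsProbabilityMeasure Pr] {f : Plane → ℝ≥0∞} (hf : Measurable f) :
    ∫⁻ ω, negExp (∑' n, f (X n ω)) ∂Pr
      = negExp (ENNReal.ofReal lam * ∫⁻ y, (1 - negExp (f y))) := by
  -- Cutting off to a ball makes the support of finite area; `eapprox` already has finite values.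
  let φ : ℕ → SimpleFunc Plane ℝ≥0∞ := fun k =>
    (SimpleFunc.eapprox f k).restrict (Metric.ball 0 k)
  have hφ : ∀ k y, φ k y = (Metric.ball (0 : Plane) k).indicator (SimpleFunc.eapprox f k) y :=
    fun k y => by rw [SimpleFunc.restrict_apply _ Metric.isOpen_ball.measurableSet]
  have hlt : ∀ k y, φ k y ≠ ⊤ := fun k y => by
    rw [hφ]
    refine ((Set.indicator_le_self _ _ y).trans_lt (SimpleFunc.eapprox_lt_top f k y)).ne
  have hfin : ∀ k, volume {y | φ k y ≠ 0} ≠ ⊤ := fun k => by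
    refine ((measure_mono fun y hy => ?_).trans_lt
      (measure_ball_lt_top (μ := volume) (x := (0 : Plane)) (r := k))).ne
    by_contra hc
    exact hy (by rw [hφ, Set.indicator_of_notMem hc])
  have hle : ∀ k y, φ k y ≤ f y := fun k y => by
    rw [hφ]
    refine (Set.indicator_le_self _ _ y).trans ?_
    rw [← SimpleFunc.iSup_eapprox_apply hf y]
    exact le_iSup (fun n => SimpleFunc.eapprox f n y) k
  have hlim : ∀ y, Tendsto (fun k => φ k y) atTop (𝓝 (f y)) := fun y => by
    refine (SimpleFunc.tendsto_eapprox hf y).congr' ?_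
    obtain ⟨N, hN⟩ := exists_nat_gt ‖y‖
    filter_upwards [eventually_ge_atTop N] with k hk
    rw [hφ, Set.indicator_of_mem]
    simpa using hN.trans_le (by exact_mod_cast hk)
  have h1 : Tendsto (fun k => ∫⁻ ω, negExp (∑' n, φ k (X n ω)) ∂Pr) atTop
      (𝓝 (∫⁻ ω, negExp (∑' n, f (X n ω)) ∂Pr)) := by
    refine tendsto_lintegral_of_dominated_convergence (fun _ => 1) (fun k => ?_)
      (fun k => Eventually.of_forall fun ω => negExp_le_one _) (by simp) ?_
    · exact measurable_negExp.comp (Measurable.tsum fun n =>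
        (φ k).measurable.comp (h.measurable n))
    · exact Eventually.of_forall fun ω => (continuous_negExp.tendsto _).comp
        (tendsto_tsum_of_le (fun k n => hle k _) fun n => hlim _)
  -- The plane has infinite area, so no constant dominates here; convergence from below replaces
  -- domination.
  have h2 : Tendsto (fun k => negExp (ENNReal.ofReal lam * ∫⁻ y, (1 - negExp (φ k y)))) atTop
      (𝓝 (negExp (ENNReal.ofReal lam * ∫⁻ y, (1 - negExp (f y))))) := by
    refine (continuous_negExp.tendsto _).comp (ENNReal.Tendsto.const_mul ?_ (Or.inr ofReal_ne_top))
    exact tendsto_lintegral_of_le (fun k => measurable_one_sub_negExp (φ k).measurable)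
      (fun k y => tsub_le_tsub_left (negExp_antitone (hle k y)) _)
      (Eventually.of_forall fun y => (continuous_one_sub_negExp.tendsto _).comp (hlim y))
  refine tendsto_nhds_unique h1 (h2.congr fun k => ?_)
  rw [h.lintegral_negExp_simpleFunc hlam (φ k) (hlt k) (hfin k)]

end Poisson

/-! ### Exponential laws and areas of discs. -/

lemma expMeasure_Ici {r : ℝ} (hr : 0 < r) {a : ℝ} (ha : 0 ≤ a) :
    expMeasure r (Set.Ici a) = ENNReal.ofReal (Real.exp (-(r * a))) := by
  have := isProbabilityMeasure_expMeasure hr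
  have : NullSingletonClass (expMeasure r) := by
    unfold expMeasure gammaMeasure
    infer_instance
  have h := ofReal_cdf (expMeasure r) a
  rw [cdf_expMeasure_eq hr, if_pos ha] at h
  rw [← measure_congr Ioi_ae_eq_Ici, ← Set.compl_Iic, prob_compl_eq_one_sub measurableSet_Iic, ← h,
    ← ENNReal.ofReal_one, ← ENNReal.ofReal_sub]
  · congr 1; ring
  · have : Real.exp (-(r * a)) ≤ 1 := Real.exp_le_one_iff.2 (by nlinarith)
    linarith

lemma expMeasure_Iio_zero (r : ℝ) : expMeasure r (Set.Iio 0) = 0 := by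
  unfold expMeasure gammaMeasure
  rw [withDensity_apply _ measurableSet_Iio]
  exact lintegral_gammaPDF_of_nonpos le_rfl

/-- Allowing `A = ⊤` lets a divergent interference sum count as certain outage. -/
lemma expMeasure_ofReal_le {r : ℝ} (hr : 0 < r) (A : ℝ≥0∞) :
    expMeasure r {x | A ≤ ENNReal.ofReal x} = negExp (ENNReal.ofReal r * A) := by
  have := isProbabilityMeasure_expMeasure hr
  induction A with
  | top => simp [ENNReal.mul_top, hr]
  | coe a =>
    rcases eq_or_lt_of_le a.coe_nonneg with h | h
    · have : a = 0 := by exact_mod_cast h.symm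
      subst this
      simp
    · have : {x : ℝ | (a : ℝ≥0∞) ≤ ENNReal.ofReal x} = Set.Ici (a : ℝ) := by
        ext x
        rw [Set.mem_ofPred_eq, ← ENNReal.ofReal_coe_nnreal, Set.mem_Ici]
        constructor
        · intro hx
          by_contra hc
          push Not at hc
          exact absurd hx (not_le.2 ((ENNReal.ofReal_lt_ofReal_iff h).2 hc))
        · exact ENNReal.ofReal_le_ofReal
      rw [this, expMeasure_Ici hr a.coe_nonneg, ← ENNReal.ofReal_coe_nnreal,
        ← ENNReal.ofReal_mul hr.le, negExp_ofReal (by positivity)]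

lemma lintegral_expMeasure (r : ℝ) (f : ℝ → ℝ≥0∞) (hf : Measurable f) :
    ∫⁻ v, f v ∂(expMeasure r)
      = ∫⁻ v in Set.Ioi (0 : ℝ), ENNReal.ofReal (r * Real.exp (-(r * v))) * f v := by
  have h1 : expMeasure r = volume.withDensity (exponentialPDF r) := rfl
  rw [h1, lintegral_withDensity_eq_lintegral_mul _ _ hf, ← lintegral_add_compl _ measurableSet_Ioi,
    setLIntegral_congr (s := (Set.Ioi (0 : ℝ))ᶜ) (t := Set.Iio 0)]
  · rw [setLIntegral_congr_fun (s := Set.Iio 0) (g := 0) measurableSet_Iio]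
    · simp only [Pi.zero_apply, lintegral_zero, add_zero]
      refine setLIntegral_congr_fun measurableSet_Ioi fun v hv => ?_
      simp only [Pi.mul_apply]
      rw [exponentialPDF_of_nonneg (le_of_lt hv)]
    · intro v hv
      simp [exponentialPDF_of_neg (Set.mem_Iio.1 hv)]
  · rw [Set.compl_Ioi]
    exact Iio_ae_eq_Iic.symm
  · exact (measurable_exponentialPDFReal r).ennreal_ofReal

lemma volume_norm_sq_lt {t : ℝ} (ht : 0 ≤ t) :
    volume {y : Plane | ‖y‖ ^ 2 < t} = ENNReal.ofReal (Real.pi * t) := by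
  have : {y : Plane | ‖y‖ ^ 2 < t} = Metric.ball 0 √t := by
    ext y
    simp only [Set.mem_ofPred_eq, mem_ball_zero_iff]
    rw [Real.lt_sqrt (norm_nonneg _)]
  rw [this, EuclideanSpace.volume_ball_fin_two, ← ENNReal.ofReal_pow (Real.sqrt_nonneg _),
    Real.sq_sqrt ht, mul_comm, ENNReal.ofReal_mul Real.pi_pos.le]

lemma measurableSet_norm_sq_lt (t : ℝ) : MeasurableSet {y : Plane | ‖y‖ ^ 2 < t} :=
  measurableSet_lt (by fun_prop) measurable_const

lemma measurableSet_le_norm_sq (t : ℝ) : MeasurableSet {y : Plane | t ≤ ‖y‖ ^ 2} :=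
  measurableSet_le measurable_const (by fun_prop)

/-! ### The closest point: measurability, existence, uniqueness and law of its distance. -/

section Nearest

variable {Ω : Type*} {X : ℕ → Ω → Plane}

lemma serving_mem_nearest {ω : Ω} (h : (nearest X ω).Nonempty) :
    serving X ω ∈ nearest X ω := Nat.sInf_mem h

lemma norm_serving_le {ω : Ω} (h : (nearest X ω).Nonempty) (n : ℕ) :
    ‖X (serving X ω) ω‖ ≤ ‖X n ω‖ := serving_mem_nearest h n

lemma le_norm_serving_sq_iff {ω : Ω} (h : (nearest X ω).Nonempty) {t : ℝ} :
    t ≤ ‖X (serving X ω) ω‖ ^ 2 ↔ ∀ n, t ≤ ‖X n ω‖ ^ 2 :=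
  ⟨fun ht n => ht.trans (by gcongr; exact norm_serving_le h n), fun ht => ht _⟩

variable [MeasurableSpace Ω]

lemma measurable_serving (hX : ∀ n, Measurable (X n)) : Measurable (serving X) := by
  have hm : ∀ n, MeasurableSet {ω | n ∈ nearest X ω} := fun n => by
    have : {ω | n ∈ nearest X ω} = ⋂ m, {ω | ‖X n ω‖ ≤ ‖X m ω‖} := by ext; simp [nearest]
    rw [this]
    exact MeasurableSet.iInter fun m => measurableSet_le (hX n).norm (hX m).norm
  refine measurable_to_countable' fun k => ?_
  -- Since `sInf ∅ = 0`, the fibre over `0` also contains the outcomes without a closest point.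
  have : serving X ⁻¹' {k} = ({ω | k ∈ nearest X ω} ∩ ⋂ j ∈ Set.Iio k, {ω | j ∈ nearest X ω}ᶜ) ∪
      ({_ω | k = 0} ∩ ⋂ j, {ω | j ∈ nearest X ω}ᶜ) := by
    ext ω
    simp only [Set.mem_preimage, Set.mem_singleton_iff, Set.mem_union, Set.mem_inter_iff,
      Set.mem_ofPred_eq, Set.mem_iInter, Set.mem_compl_iff, Set.mem_Iio]
    constructor
    · rintro rfl
      by_cases h : (nearest X ω).Nonempty
      · exact Or.inl ⟨serving_mem_nearest h, fun j hj => Nat.notMem_of_lt_sInf hj⟩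
      · rw [Set.not_nonempty_iff_eq_empty] at h
        exact Or.inr ⟨by simp [serving, h], by simp [h]⟩
    · rintro (⟨h1, h2⟩ | ⟨rfl, h2⟩)
      · refine le_antisymm (Nat.sInf_le h1) ?_
        by_contra hc
        exact h2 _ (not_le.1 hc) (serving_mem_nearest ⟨_, h1⟩)
      · have : nearest X ω = ∅ := Set.eq_empty_of_forall_notMem h2
        simp [serving, this]
  rw [this]
  exact ((hm k).inter (MeasurableSet.biInter (Set.to_countable _) fun j _ => (hm j).compl)).union
    ((MeasurableSet.const _).inter (MeasurableSet.iInter fun j => (hm j).compl))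

lemma measurable_apply_index {β : Type*} [MeasurableSpace β] {f : ℕ → Ω → β} {k : Ω → ℕ}
    (hf : ∀ n, Measurable (f n)) (hk : Measurable k) : Measurable fun ω => f (k ω) ω :=
  (measurable_from_prod_countable_right (f := fun p : ℕ × Ω => f p.1 p.2) hf).comp
    (hk.prodMk measurable_id)

end Nearest

section Poisson

variable {Ω : Type*} [MeasurableSpace Ω] {Pr : Measure Ω} {lam : ℝ}
  {X : ℕ → Ω → Plane}

lemma IsPoissonProcess.measurable_norm_serving_sq (h : IsPoissonProcess Pr lam X) :
    Measurable fun ω => ‖X (serving X ω) ω‖ ^ 2 :=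
  (measurable_apply_index h.measurable (measurable_serving h.measurable)).norm.pow_const 2

/-- A ball containing `X 0 ω` almost surely holds finitely many points, and the closest of them is
closest overall. -/
lemma IsPoissonProcess.ae_nearest_nonempty (h : IsPoissonProcess Pr lam X) :
    ∀ᵐ ω ∂Pr, (nearest X ω).Nonempty := by
  have h1 : ∀ N : ℕ, ∀ᵐ ω ∂Pr, pointCount X (Metric.ball 0 N) ω ≠ ⊤ := fun N => by
    rw [(h.hasLaw_pointCount _ Metric.isOpen_ball.measurableSet measure_ball_lt_top.ne).ae_iff
      (p := (· ≠ ⊤)) (Measurable.of_discrete), ae_map_iff Measurable.of_discrete.aemeasurable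
        (MeasurableSet.of_discrete)]
    exact Eventually.of_forall fun k => ENat.natCast_ne_top k
  filter_upwards [ae_all_iff.2 h1] with ω hω
  obtain ⟨N, hN⟩ := exists_nat_gt ‖X 0 ω‖
  have hfin : {n : ℕ | X n ω ∈ Metric.ball (0 : Plane) N}.Finite := Set.encard_ne_top_iff.1 (hω N)
  obtain ⟨n, hn, hmin⟩ := Set.exists_min_image _ (fun n => ‖X n ω‖) hfin ⟨0, by simpa using hN⟩
  refine ⟨n, fun m => ?_⟩
  by_cases hm : X m ω ∈ Metric.ball (0 : Plane) N
  · exact hmin m hm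
  · exact (mem_ball_zero_iff.1 hn).le.trans (by simpa using hm)

/-- From `exp (-x) ≥ 1 - x` one gets `1 - (1 + x) * exp (-x) ≤ x ^ 2`. The quadratic order is what
makes a union bound over many thin annuli vanish. -/
lemma IsPoissonProcess.measure_two_le_pointCount_le (h : IsPoissonProcess Pr lam X)
    {B : Set Plane} (hB : MeasurableSet B) (hfin : volume B ≠ ⊤) :
    Pr {ω | 2 ≤ pointCount X B ω} ≤ ENNReal.ofReal ((lam * (volume B).toReal).toNNReal ^ 2) := by
  set x := (lam * (volume B).toReal).toNNReal
  rw [(h.hasLaw_pointCount B hB hfin).measure_eq (p := fun k => 2 ≤ k) MeasurableSet.of_discrete,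
    Measure.map_apply Measurable.of_discrete MeasurableSet.of_discrete]
  have : (fun k : ℕ => (k : ℕ∞)) ⁻¹' {k | 2 ≤ k} = ({0, 1} : Set ℕ)ᶜ := by
    ext k
    simp only [Set.mem_preimage, Set.mem_ofPred_eq, Set.mem_compl_iff, Set.mem_insert_iff,
      Set.mem_singleton_iff]
    rw [show (2 : ℕ∞) = ((2 : ℕ) : ℕ∞) from rfl, Nat.cast_le]
    omega
  rw [this, ← ofReal_measureReal, probReal_compl_eq_one_sub MeasurableSet.of_discrete,
    ← Set.singleton_union, measureReal_union (by simp) (measurableSet_singleton _),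
    poissonMeasure_real_singleton, poissonMeasure_real_singleton]
  refine ENNReal.ofReal_le_ofReal ?_
  have := Real.add_one_le_exp (-(x : ℝ))
  have hx : 0 ≤ (x : ℝ) := x.coe_nonneg
  simp only [pow_zero, pow_one, Nat.factorial]
  push_cast
  nlinarith

/-- Almost surely, no two points have the same distance to the origin. -/
lemma IsPoissonProcess.ae_norm_injective (h : IsPoissonProcess Pr lam X) (hlam : 0 ≤ lam) :
    ∀ᵐ ω ∂Pr, ∀ m n, m ≠ n → ‖X m ω‖ ≠ ‖X n ω‖ := by
  have key : ∀ N : ℕ, Pr {ω | ∃ m n, m ≠ n ∧ ‖X m ω‖ = ‖X n ω‖ ∧ ‖X m ω‖ ^ 2 < N} = 0 := by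
    intro N
    have hle : ∀ J : ℕ, Pr {ω | ∃ m n, m ≠ n ∧ ‖X m ω‖ = ‖X n ω‖ ∧ ‖X m ω‖ ^ 2 < N}
        ≤ ENNReal.ofReal (N * (lam * Real.pi) ^ 2 * ((J : ℝ) + 1)⁻¹) := by
      intro J
      -- Annuli of equal area `π / (J + 1)`. Equidistant points share an annulus, and `N * (J + 1)`
      -- of them fill the disc, so the union bound is of order `1 / J`.
      let A : ℕ → Set Plane := fun i =>
        {y | ‖y‖ ^ 2 < ((i : ℝ) + 1) / (J + 1)} \ {y | ‖y‖ ^ 2 < (i : ℝ) / (J + 1)}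
      have hA : ∀ i, MeasurableSet (A i) := fun i =>
        (measurableSet_norm_sq_lt _).diff (measurableSet_norm_sq_lt _)
      have hvol : ∀ i, volume (A i) = ENNReal.ofReal (Real.pi * ((J : ℝ) + 1)⁻¹) := fun i => by
        rw [measure_sdiff _ (measurableSet_norm_sq_lt _).nullMeasurableSet, volume_norm_sq_lt
          (by positivity), volume_norm_sq_lt (by positivity), ← ENNReal.ofReal_sub _ (by positivity)]
        · congr 1; ring
        · rw [volume_norm_sq_lt (by positivity)]; exact ofReal_ne_top
        · intro y (hy : ‖y‖ ^ 2 < (i : ℝ) / (J + 1))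
          exact hy.trans_le (by gcongr; linarith)
      calc _ ≤ Pr (⋃ i ∈ Finset.range (N * (J + 1)), {ω | 2 ≤ pointCount X (A i) ω}) := by
            refine measure_mono fun ω ⟨m, n, hmn, heq, hlt⟩ => ?_
            have hJ : (0 : ℝ) < J + 1 := by positivity
            have hnn : 0 ≤ ‖X m ω‖ ^ 2 * (J + 1) := by positivity
            have h1 := Nat.floor_le hnn
            have h2 := Nat.lt_floor_add_one (‖X m ω‖ ^ 2 * (J + 1))
            have hin : X m ω ∈ A ⌊‖X m ω‖ ^ 2 * (J + 1)⌋₊ :=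
              ⟨(lt_div_iff₀ hJ).2 h2, not_lt.2 ((div_le_iff₀ hJ).2 h1)⟩
            simp only [Set.mem_iUnion, Finset.mem_range, exists_prop]
            refine ⟨⌊‖X m ω‖ ^ 2 * (J + 1)⌋₊, ?_, ?_⟩
            · rw [Nat.floor_lt hnn]
              push_cast
              gcongr
            · have hin' : X n ω ∈ A ⌊‖X m ω‖ ^ 2 * (J + 1)⌋₊ := by
                simpa only [A, Set.mem_sdiff, Set.mem_ofPred_eq, heq] using hin
              have : ({m, n} : Set ℕ) ⊆ {k | X k ω ∈ A ⌊‖X m ω‖ ^ 2 * (J + 1)⌋₊} := by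
                rintro k (rfl | rfl)
                exacts [hin, hin']
              change 2 ≤ Set.encard _
              rw [← Set.encard_pair hmn]
              exact Set.encard_le_encard this
        _ ≤ ∑ i ∈ Finset.range (N * (J + 1)), Pr {ω | 2 ≤ pointCount X (A i) ω} :=
            measure_biUnion_finset_le _ _
        _ ≤ ∑ i ∈ Finset.range (N * (J + 1)),
              ENNReal.ofReal ((lam * Real.pi * ((J : ℝ) + 1)⁻¹) ^ 2) := by
            refine Finset.sum_le_sum fun i _ => ?_
            refine (h.measure_two_le_pointCount_le (hA i) (by rw [hvol]; exact ofReal_ne_top)).trans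
              (le_of_eq ?_)
            rw [hvol, ENNReal.toReal_ofReal (by positivity), Real.coe_toNNReal _ (by positivity)]
            congr 1; ring
        _ = _ := by
            rw [Finset.sum_const, Finset.card_range, nsmul_eq_mul, ← ENNReal.ofReal_natCast,
              ← ENNReal.ofReal_mul (by positivity)]
            congr 1
            push_cast
            field_simp
    have hlim : Tendsto (fun J : ℕ => ENNReal.ofReal (N * (lam * Real.pi) ^ 2 * ((J : ℝ) + 1)⁻¹))
        atTop (𝓝 0) := by
      rw [← ENNReal.ofReal_zero]
      refine ENNReal.tendsto_ofReal ?_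
      have := tendsto_one_div_add_atTop_nhds_zero_nat (𝕜 := ℝ)
      simpa using this.const_mul (N * (lam * Real.pi) ^ 2)
    exact le_antisymm (ge_of_tendsto' hlim hle) bot_le
  filter_upwards [ae_all_iff.2 fun N => measure_eq_zero_iff_ae_notMem.1 (key N)] with ω hω m n hmn heq
  obtain ⟨N, hN⟩ := exists_nat_gt (‖X m ω‖ ^ 2)
  exact hω N ⟨m, n, hmn, heq, hN⟩

variable [IsProbabilityMeasure Pr]

/-- The Laplace functional outside a disc, on the event that there are no points in a smaller
disc. -/
lemma IsPoissonProcess.setLIntegral_negExp_tsum (h : IsPoissonProcess Pr lam X) (hlam : 0 ≤ lam)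
    {f : Plane → ℝ≥0∞} (hf : Measurable f) {t u : ℝ} (ht : 0 ≤ t) (htu : t ≤ u) :
    ∫⁻ ω in {ω | t ≤ ‖X (serving X ω) ω‖ ^ 2},
        negExp (∑' n, {y : Plane | u ≤ ‖y‖ ^ 2}.indicator f (X n ω)) ∂Pr
      = negExp (ENNReal.ofReal lam * ENNReal.ofReal (Real.pi * t)) *
        negExp (ENNReal.ofReal lam *
          ∫⁻ y, {y : Plane | u ≤ ‖y‖ ^ 2}.indicator (fun y => 1 - negExp (f y)) y) := by
  let B := {y : Plane | ‖y‖ ^ 2 < t}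
  let C := {y : Plane | u ≤ ‖y‖ ^ 2}
  have hB : MeasurableSet B := measurableSet_norm_sq_lt t
  have hC : MeasurableSet C := measurableSet_le_norm_sq u
  have hBC : ∀ y, y ∈ B → y ∉ C := fun y hy hc =>
    absurd (htu.trans hc) (not_le.2 hy)
  -- Weight `⊤` on the inner disc encodes the event that it is empty, since `negExp ⊤ = 0`; the
  -- Laplace functional of `f'` then gives everything at once.
  let f' : Plane → ℝ≥0∞ := fun y => B.indicator (fun _ => ⊤) y + C.indicator f y
  have hf' : Measurable f' := (measurable_const.indicator hB).add (hf.indicator hC)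
  have key := h.lintegral_negExp_tsum hlam hf'
  rw [← lintegral_indicator (measurableSet_le measurable_const h.measurable_norm_serving_sq)]
  have e1 : ∀ᵐ ω ∂Pr, {ω | t ≤ ‖X (serving X ω) ω‖ ^ 2}.indicator
      (fun ω => negExp (∑' n, C.indicator f (X n ω))) ω = negExp (∑' n, f' (X n ω)) := by
    filter_upwards [h.ae_nearest_nonempty] with ω hω
    by_cases hmem : t ≤ ‖X (serving X ω) ω‖ ^ 2
    · rw [Set.indicator_of_mem (by exact hmem)]
      rw [le_norm_serving_sq_iff hω] at hmem
      congr 2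
      ext n
      have : X n ω ∉ B := not_lt.2 (hmem n)
      simp [f', this]
    · rw [Set.indicator_of_notMem (by exact hmem), ENNReal.tsum_eq_top_of_eq_top, negExp_top]
      refine ⟨serving X ω, ?_⟩
      have : X (serving X ω) ω ∈ B := not_le.1 hmem
      simp [f', this]
  rw [lintegral_congr_ae e1, key, ← negExp_add, ← mul_add]
  congr 2
  have e2 : ∀ y, 1 - negExp (f' y) = B.indicator (fun _ => 1) y +
      C.indicator (fun y => 1 - negExp (f y)) y := fun y => by
    by_cases hy : y ∈ B
    · simp [f', hy, hBC y hy]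
    · by_cases hy2 : y ∈ C <;> simp [f', hy, hy2]
  rw [lintegral_congr e2, lintegral_add_left (measurable_const.indicator hB),
    lintegral_indicator hB, setLIntegral_one, volume_norm_sq_lt ht]

lemma IsPoissonProcess.measure_le_norm_serving_sq (h : IsPoissonProcess Pr lam X) (hlam : 0 ≤ lam)
    {t : ℝ} (ht : 0 ≤ t) :
    Pr {ω | t ≤ ‖X (serving X ω) ω‖ ^ 2}
      = negExp (ENNReal.ofReal lam * ENNReal.ofReal (Real.pi * t)) := by
  have := h.setLIntegral_negExp_tsum hlam (f := fun _ => 0) measurable_const ht le_rfl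
  simpa using this

/-- The squared distance to the closest point is exponentially distributed. -/
lemma IsPoissonProcess.map_norm_serving_sq (h : IsPoissonProcess Pr lam X) (hlam : 0 < lam) :
    Pr.map (fun ω => ‖X (serving X ω) ω‖ ^ 2) = expMeasure (Real.pi * lam) := by
  have hr : 0 < Real.pi * lam := mul_pos Real.pi_pos hlam
  have := isProbabilityMeasure_expMeasure hr
  have := Measure.isProbabilityMeasure_map (μ := Pr) h.measurable_norm_serving_sq.aemeasurable
  refine Measure.ext_of_Ici _ _ fun a => ?_
  have hpos : ∀ b : ℝ, 0 ≤ b → Pr.map (fun ω => ‖X (serving X ω) ω‖ ^ 2) (Set.Ici b)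
      = expMeasure (Real.pi * lam) (Set.Ici b) := fun b hb => by
    rw [Measure.map_apply h.measurable_norm_serving_sq measurableSet_Ici, expMeasure_Ici hr hb]
    refine (h.measure_le_norm_serving_sq hlam.le hb).trans ?_
    rw [← ENNReal.ofReal_mul hlam.le, negExp_ofReal (by positivity)]
    congr 3; ring
  rcases le_or_gt 0 a with ha | ha
  · exact hpos a ha
  · have h0 : expMeasure (Real.pi * lam) (Set.Ici 0) = 1 := by
      rw [expMeasure_Ici hr le_rfl]; simp
    have h1 := hpos 0 le_rfl
    rw [h0] at h1
    have hsub : Set.Ici (0 : ℝ) ⊆ Set.Ici a := Set.Ici_subset_Ici.2 ha.le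
    rw [le_antisymm prob_le_one (h1.symm.le.trans (measure_mono hsub)),
      le_antisymm prob_le_one (h0.symm.le.trans (measure_mono hsub))]

lemma IsPoissonProcess.ae_norm_serving_pos (h : IsPoissonProcess Pr lam X) (hlam : 0 < lam) :
    ∀ᵐ ω ∂Pr, 0 < ‖X (serving X ω) ω‖ := by
  have : NullSingletonClass (expMeasure (Real.pi * lam)) := by
    unfold expMeasure gammaMeasure
    infer_instance
  have h1 : Pr ((fun ω => ‖X (serving X ω) ω‖ ^ 2) ⁻¹' {0}) = 0 := by
    rw [← Measure.map_apply h.measurable_norm_serving_sq (measurableSet_singleton _),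
      h.map_norm_serving_sq hlam, measure_singleton]
  rw [ae_iff]
  refine measure_mono_null (fun ω hω => ?_) h1
  have : ‖X (serving X ω) ω‖ = 0 := le_antisymm (not_lt.1 hω) (norm_nonneg _)
  simp [this]

end Poisson

/-! ### Conditioning on the distance to the closest point. -/

lemma lintegral_congr_of_fibers {Ω : Type*} [MeasurableSpace Ω] {μ : Measure Ω} {K : Ω → ℕ}
    (hK : Measurable K) {f g : Ω → ℝ≥0∞}
    (h : ∀ k, ∫⁻ ω in K ⁻¹' {k}, f ω ∂μ = ∫⁻ ω in K ⁻¹' {k}, g ω ∂μ) :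
    ∫⁻ ω, f ω ∂μ = ∫⁻ ω, g ω ∂μ := by
  have hU : (⋃ k, K ⁻¹' {k}) = Set.univ := by ext; simp
  have hd : Pairwise (Function.onFun Disjoint fun k => K ⁻¹' {k}) := fun i j hij =>
    Disjoint.preimage _ (Set.disjoint_singleton.2 hij)
  have hm : ∀ k, MeasurableSet (K ⁻¹' {k}) := fun k => hK (measurableSet_singleton k)
  rw [← setLIntegral_univ f, ← setLIntegral_univ g, ← hU, lintegral_iUnion hm hd,
    lintegral_iUnion hm hd]
  exact tsum_congr h

/-- Discretized radii approximate the region outside a disc from inside. -/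
lemma indicator_floor_le {F : ℝ → Plane → ℝ≥0∞} (hmono : ∀ y, MonotoneOn (fun v => F v y) (Set.Ici 0))
    {v : ℝ} (hv : 0 ≤ v) (j : ℕ) (y : Plane) :
    {y : Plane | ((⌊v * (j + 1)⌋₊ : ℝ) + 1) / (j + 1) ≤ ‖y‖ ^ 2}.indicator
        (F ((⌊v * (j + 1)⌋₊ : ℝ) / (j + 1))) y ≤ {y : Plane | v < ‖y‖ ^ 2}.indicator (F v) y := by
  have hj : (0 : ℝ) < j + 1 := by positivity
  refine (Set.indicator_le_indicator' (g := F v) fun _ => ?_).trans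
    (Set.indicator_le_indicator_of_subset (fun y hy => ?_) (fun _ => bot_le) y)
  · refine hmono y (Set.mem_Ici.2 (by positivity)) hv ?_
    exact (div_le_iff₀ hj).2 (Nat.floor_le (by positivity))
  · exact ((lt_div_iff₀ hj).2 (Nat.lt_floor_add_one _)).trans_le hy

lemma tendsto_floor_mul_div {v : ℝ} (hv : 0 ≤ v) :
    Tendsto (fun j : ℕ => (⌊v * (j + 1)⌋₊ : ℝ) / (j + 1)) atTop (𝓝 v) := by
  have h := (tendsto_nat_floor_mul_div_atTop hv).comp
    (tendsto_atTop_add_const_right atTop (1 : ℝ) (tendsto_natCast_atTop_atTop (R := ℝ)))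
  exact h

/-- If `v < ‖y‖ ^ 2`, the outer end of the cell, tending to `v`, eventually drops below `‖y‖ ^ 2`;
otherwise it stays above, being always larger than `v`. -/
lemma tendsto_indicator_floor {F : ℝ → Plane → ℝ≥0∞} (hcont : ∀ y, Continuous fun v => F v y)
    {v : ℝ} (hv : 0 ≤ v) (y : Plane) :
    Tendsto (fun j : ℕ => {y : Plane | ((⌊v * (j + 1)⌋₊ : ℝ) + 1) / (j + 1) ≤ ‖y‖ ^ 2}.indicator
        (F ((⌊v * (j + 1)⌋₊ : ℝ) / (j + 1))) y) atTop
      (𝓝 ({y : Plane | v < ‖y‖ ^ 2}.indicator (F v) y)) := by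
  by_cases hy : v < ‖y‖ ^ 2
  · have hlim := tendsto_floor_mul_div hv
    have h1 : Tendsto (fun j : ℕ => ((⌊v * (j + 1)⌋₊ : ℝ) + 1) / (j + 1)) atTop (𝓝 v) := by
      simpa [add_div] using hlim.add (tendsto_one_div_add_atTop_nhds_zero_nat (𝕜 := ℝ))
    rw [Set.indicator_of_mem (by exact hy)]
    refine (((hcont y).tendsto v).comp hlim).congr' ?_
    filter_upwards [h1.eventually_lt_const hy] with j hj
    rw [Set.indicator_of_mem (by exact hj.le)]
    rfl
  · rw [Set.indicator_of_notMem (by exact hy)]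
    refine tendsto_const_nhds.congr fun j => ?_
    rw [Set.indicator_of_notMem]
    intro (hc : _ ≤ ‖y‖ ^ 2)
    have hj : (0 : ℝ) < j + 1 := by positivity
    exact hy (((lt_div_iff₀ hj).2 (Nat.lt_floor_add_one _)).trans_le hc)

section Poisson

variable {Ω : Type*} [MeasurableSpace Ω] {Pr : Measure Ω} [IsProbabilityMeasure Pr] {lam : ℝ}
  {X : ℕ → Ω → Plane}

/-- Subtract the identity on `{u ≤ D}` from that on `{t ≤ D}`, with `D` the squared distance: both
contain the same factor, since only points beyond `u` enter. Thus `D ∈ [t, u)` is independent of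
those points. -/
lemma IsPoissonProcess.setLIntegral_Ico_negExp_tsum (h : IsPoissonProcess Pr lam X) (hlam : 0 ≤ lam)
    {f : Plane → ℝ≥0∞} (hf : Measurable f) {t u : ℝ} (ht : 0 ≤ t) (htu : t ≤ u) :
    ∫⁻ ω in (fun ω => ‖X (serving X ω) ω‖ ^ 2) ⁻¹' Set.Ico t u,
        negExp (∑' n, {y : Plane | u ≤ ‖y‖ ^ 2}.indicator f (X n ω)) ∂Pr
      = ∫⁻ _ω in (fun ω => ‖X (serving X ω) ω‖ ^ 2) ⁻¹' Set.Ico t u, negExp (ENNReal.ofReal lam *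
          ∫⁻ y, {y : Plane | u ≤ ‖y‖ ^ 2}.indicator (fun y => 1 - negExp (f y)) y) ∂Pr := by
  have hD := h.measurable_norm_serving_sq
  set D := fun ω => ‖X (serving X ω) ω‖ ^ 2
  have hsplit : ∀ g : Ω → ℝ≥0∞, ∫⁻ ω in {ω | t ≤ D ω}, g ω ∂Pr
      = ∫⁻ ω in D ⁻¹' Set.Ico t u, g ω ∂Pr + ∫⁻ ω in {ω | u ≤ D ω}, g ω ∂Pr := fun g => by
    rw [← lintegral_union (measurableSet_le measurable_const hD)]
    · congr 2
      ext ω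
      simp only [Set.mem_ofPred_eq, Set.mem_union, Set.mem_preimage, Set.mem_Ico]
      constructor
      · intro h1
        rcases lt_or_ge (D ω) u with h2 | h2
        exacts [Or.inl ⟨h1, h2⟩, Or.inr h2]
      · rintro (h1 | h1)
        exacts [h1.1, htu.trans h1]
    · rw [Set.disjoint_left]
      exact fun ω h1 h2 => absurd h1.2 (not_lt.2 h2)
  have h1 := h.setLIntegral_negExp_tsum hlam hf ht htu
  have h2 := h.setLIntegral_negExp_tsum hlam hf (ht.trans htu) le_rfl
  set c := negExp (ENNReal.ofReal lam *
          ∫⁻ y, {y : Plane | u ≤ ‖y‖ ^ 2}.indicator (fun y => 1 - negExp (f y)) y)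
  rw [← h.measure_le_norm_serving_sq hlam ht, mul_comm, ← setLIntegral_const, hsplit, hsplit] at h1
  rw [← h.measure_le_norm_serving_sq hlam (ht.trans htu), mul_comm, ← setLIntegral_const] at h2
  rw [h2] at h1
  refine (ENNReal.add_left_inj ?_).1 h1
  rw [setLIntegral_const]
  exact ENNReal.mul_ne_top (negExp_ne_top _) (measure_ne_top _ _)

/-- Given the distance to the closest point, the other points form a Poisson process outside the
corresponding disc. -/
theorem IsPoissonProcess.lintegral_nearest (h : IsPoissonProcess Pr lam X) (hlam : 0 < lam)
    {F : ℝ → Plane → ℝ≥0∞} (hF : Measurable fun p : ℝ × Plane => F p.1 p.2)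
    (hmono : ∀ y, MonotoneOn (fun v => F v y) (Set.Ici 0)) (hcont : ∀ y, Continuous fun v => F v y)
    {H : ℝ → ℝ≥0∞} (hH : Continuous H) (hH1 : ∀ v, H v ≤ 1) :
    ∫⁻ ω, H (‖X (serving X ω) ω‖ ^ 2) * negExp (∑' n,
        {y : Plane | ‖X (serving X ω) ω‖ ^ 2 < ‖y‖ ^ 2}.indicator
          (F (‖X (serving X ω) ω‖ ^ 2)) (X n ω)) ∂Pr
      = ∫⁻ v in Set.Ioi (0 : ℝ), ENNReal.ofReal (Real.pi * lam * Real.exp (-(Real.pi * lam * v))) *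
        (H v * negExp (ENNReal.ofReal lam *
          ∫⁻ y, {y : Plane | v < ‖y‖ ^ 2}.indicator (fun y => 1 - negExp (F v y)) y)) := by
  have hD := h.measurable_norm_serving_sq
  set D := fun ω => ‖X (serving X ω) ω‖ ^ 2 with hDdef
  have hD0 : ∀ ω, 0 ≤ D ω := fun ω => by positivity
  have hFs : ∀ v, Measurable (F v) := fun v => hF.comp measurable_prodMk_left
  have hG : Measurable fun v : ℝ => ∫⁻ y, {y : Plane | v < ‖y‖ ^ 2}.indicator
      (fun y => 1 - negExp (F v y)) y := by
    refine Measurable.lintegral_prod_right' (f := fun p : ℝ × Plane =>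
      {y : Plane | p.1 < ‖y‖ ^ 2}.indicator (fun y => 1 - negExp (F p.1 y)) p.2) ?_
    have : MeasurableSet {p : ℝ × Plane | p.1 < ‖p.2‖ ^ 2} :=
      measurableSet_lt measurable_fst (by fun_prop)
    exact (measurable_one_sub_negExp hF).indicator this
  have hrhs : Measurable fun v => H v * negExp (ENNReal.ofReal lam *
      ∫⁻ y, {y : Plane | v < ‖y‖ ^ 2}.indicator (fun y => 1 - negExp (F v y)) y) :=
    hH.measurable.mul (measurable_negExp.comp (hG.const_mul _))
  rw [← lintegral_expMeasure _ _ hrhs, ← h.map_norm_serving_sq hlam, lintegral_map hrhs hD]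
  -- Instead of disintegrating, `D` is localized to the cell `[v j k, u j k)` of width `1 / (j +
  -- 1)`. On a cell, `F` is frozen at the lower end and only points beyond the upper end are kept,
  -- which makes independence available; then `j → ∞`.
  let K : ℕ → Ω → ℕ := fun j ω => ⌊D ω * (j + 1)⌋₊
  have hK : ∀ j, Measurable (K j) := fun j => Nat.measurable_floor.comp (hD.mul_const _)
  let v : ℕ → ℕ → ℝ := fun j k => (k : ℝ) / (j + 1)
  let u : ℕ → ℕ → ℝ := fun j k => ((k : ℝ) + 1) / (j + 1)
  let S : ℕ → ℕ → Ω → ℝ≥0∞ := fun j k ω =>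
    negExp (∑' n, {y : Plane | u j k ≤ ‖y‖ ^ 2}.indicator (F (v j k)) (X n ω))
  let L : ℕ → ℕ → ℝ≥0∞ := fun j k => negExp (ENNReal.ofReal lam *
    ∫⁻ y, {y : Plane | u j k ≤ ‖y‖ ^ 2}.indicator (fun y => 1 - negExp (F (v j k) y)) y)
  have hS : ∀ j k, Measurable (S j k) := fun j k => measurable_negExp.comp
    (Measurable.tsum fun n => ((hFs _).indicator (measurableSet_le_norm_sq _)).comp (h.measurable n))
  have hfib : ∀ j k, K j ⁻¹' {k} = D ⁻¹' Set.Ico (v j k) (u j k) := fun j k => by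
    have hj : (0 : ℝ) < j + 1 := by positivity
    ext ω
    simp only [Set.mem_preimage, Set.mem_singleton_iff, Set.mem_Ico, K, v, u]
    rw [Nat.floor_eq_iff (mul_nonneg (hD0 ω) hj.le), div_le_iff₀ hj, lt_div_iff₀ hj]
  have hdisc : ∀ j, ∫⁻ ω, H (v j (K j ω)) * S j (K j ω) ω ∂Pr
      = ∫⁻ ω, H (v j (K j ω)) * L j (K j ω) ∂Pr := fun j => by
    refine lintegral_congr_of_fibers (hK j) fun k => ?_
    have hm : MeasurableSet (K j ⁻¹' {k}) := hK j (measurableSet_singleton k)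
    refine (setLIntegral_congr_fun (g := fun ω => H (v j k) * S j k ω) hm fun ω hω => ?_).trans
      (Eq.trans ?_ (setLIntegral_congr_fun (f := fun ω => H (v j k) * L j k) hm fun ω hω => ?_))
    · rw [show K j ω = k from hω]
    swap
    · rw [show K j ω = k from hω]
    rw [lintegral_const_mul _ (hS j k), lintegral_const_mul _ measurable_const, hfib]
    congr 1
    refine h.setLIntegral_Ico_negExp_tsum hlam.le (hFs _) (by positivity) ?_
    simp only [v, u]
    gcongr
    linarith
  have hlimH : ∀ ω, Tendsto (fun j => H (v j (K j ω))) atTop (𝓝 (H (D ω))) := fun ω =>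
    (hH.tendsto _).comp (tendsto_floor_mul_div (hD0 ω))
  have h1 : Tendsto (fun j => ∫⁻ ω, H (v j (K j ω)) * S j (K j ω) ω ∂Pr) atTop
      (𝓝 (∫⁻ ω, H (D ω) * negExp (∑' n, {y : Plane | D ω < ‖y‖ ^ 2}.indicator
          (F (D ω)) (X n ω)) ∂Pr)) := by
    refine tendsto_lintegral_of_dominated_convergence (fun _ => 1) (fun j => ?_)
      (fun j => Eventually.of_forall fun ω => mul_le_one' (hH1 _) (negExp_le_one _)) (by simp)
      (Eventually.of_forall fun ω => ?_)
    · exact (hH.measurable.comp ((Measurable.of_discrete (f := v j)).comp (hK j))).mul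
        (measurable_apply_index (hS j) (hK j))
    · refine ENNReal.Tendsto.mul (hlimH ω) (Or.inr (negExp_ne_top _))
        ((continuous_negExp.tendsto _).comp ?_) (Or.inr ((hH1 _).trans_lt one_lt_top).ne)
      exact tendsto_tsum_of_le (fun j n => indicator_floor_le hmono (hD0 ω) j (X n ω))
        fun n => tendsto_indicator_floor hcont (hD0 ω) (X n ω)
  have h2 : Tendsto (fun j => ∫⁻ ω, H (v j (K j ω)) * L j (K j ω) ∂Pr) atTop
      (𝓝 (∫⁻ ω, H (D ω) * negExp (ENNReal.ofReal lam *
        ∫⁻ y, {y : Plane | D ω < ‖y‖ ^ 2}.indicator (fun y => 1 - negExp (F (D ω) y)) y) ∂Pr)) := by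
    refine tendsto_lintegral_of_dominated_convergence (fun _ => 1) (fun j => ?_)
      (fun j => Eventually.of_forall fun ω => mul_le_one' (hH1 _) (negExp_le_one _)) (by simp)
      (Eventually.of_forall fun ω => ?_)
    · exact (hH.measurable.comp ((Measurable.of_discrete (f := v j)).comp (hK j))).mul
        ((Measurable.of_discrete (f := L j)).comp (hK j))
    · refine ENNReal.Tendsto.mul (hlimH ω) (Or.inr (negExp_ne_top _))
        ((continuous_negExp.tendsto _).comp (ENNReal.Tendsto.const_mul ?_ (Or.inr ofReal_ne_top)))
        (Or.inr ((hH1 _).trans_lt one_lt_top).ne)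
      refine tendsto_lintegral_of_le (fun j => ?_)
        (fun j y => indicator_floor_le (F := fun v y => 1 - negExp (F v y)) (fun y a ha b hb hab =>
          tsub_le_tsub_left (negExp_antitone (hmono y ha hb hab)) _) (hD0 ω) j y)
        (Eventually.of_forall fun y => tendsto_indicator_floor (F := fun v y => 1 - negExp (F v y))
          (fun y => continuous_one_sub_negExp.comp (hcont y)) (hD0 ω) y)
      exact (measurable_one_sub_negExp (hFs _)).indicator (measurableSet_le_norm_sq _)
  exact tendsto_nhds_unique h1 (h2.congr fun j => (hdisc j).symm)

end Poisson

/-! ### The factor contributed by one interferer. -/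

/-- The factor by which an interferer reduces the coverage probability, where `a` and `b` are the
thresholds on the common and on the edge sub-band, and `w` is the path loss of the interferer
relative to that of the serving base station. -/
noncomputable def interfererFactor (a b : ℝ) (Δ : ℕ) (w : ℝ) : ℝ :=
  1 / (1 + a * w) * (1 - 1 / (Δ : ℝ) * (1 - 1 / (1 + b * w)))

section Factor

variable {a b w : ℝ} {Δ : ℕ}

lemma edgeFactor_mem (hb : 0 ≤ b) (hw : 0 ≤ w) (hΔ : 0 < Δ) :
    0 < 1 - 1 / (Δ : ℝ) * (1 - 1 / (1 + b * w)) ∧ 1 - 1 / (Δ : ℝ) * (1 - 1 / (1 + b * w)) ≤ 1 := by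
  have hΔ' : (1 : ℝ) ≤ Δ := by exact_mod_cast hΔ
  have h1 : 0 < 1 / (1 + b * w) := by positivity
  have h2 : 1 / (1 + b * w) ≤ 1 := by
    rw [div_le_one (by positivity)]
    nlinarith [mul_nonneg hb hw]
  have h3 : 0 < 1 / (Δ : ℝ) := by positivity
  have h4 : 1 / (Δ : ℝ) ≤ 1 := by rw [div_le_one (by positivity)]; exact hΔ'
  constructor <;> nlinarith

lemma interfererFactor_pos (ha : 0 ≤ a) (hb : 0 ≤ b) (hw : 0 ≤ w) (hΔ : 0 < Δ) :
    0 < interfererFactor a b Δ w :=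
  mul_pos (by positivity) (edgeFactor_mem hb hw hΔ).1

lemma interfererFactor_le_one (ha : 0 ≤ a) (hb : 0 ≤ b) (hw : 0 ≤ w) (hΔ : 0 < Δ) :
    interfererFactor a b Δ w ≤ 1 := by
  refine mul_le_one₀ ?_ (edgeFactor_mem hb hw hΔ).1.le (edgeFactor_mem hb hw hΔ).2
  rw [div_le_one (by positivity)]
  nlinarith [mul_nonneg ha hw]

@[simp] lemma interfererFactor_zero : interfererFactor a b Δ 0 = 1 := by simp [interfererFactor]

lemma interfererFactor_antitoneOn (ha : 0 ≤ a) (hb : 0 ≤ b) (hΔ : 0 < Δ) :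
    AntitoneOn (interfererFactor a b Δ) (Set.Ici 0) := by
  intro w (hw : 0 ≤ w) w' (hw' : 0 ≤ w') h
  unfold interfererFactor
  have h1 := (edgeFactor_mem hb hw' hΔ).1.le
  gcongr

lemma continuousOn_interfererFactor (ha : 0 ≤ a) (hb : 0 ≤ b) :
    ContinuousOn (interfererFactor a b Δ) (Set.Ici 0) := by
  have h1 : ∀ w ∈ Set.Ici (0 : ℝ), 1 + a * w ≠ 0 := fun w (hw : 0 ≤ w) => by positivity
  have h2 : ∀ w ∈ Set.Ici (0 : ℝ), 1 + b * w ≠ 0 := fun w (hw : 0 ≤ w) => by positivity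
  unfold interfererFactor
  fun_prop (disch := assumption)

lemma measurable_interfererFactor : Measurable (interfererFactor a b Δ) := by
  unfold interfererFactor
  fun_prop

/-- Writing the factor as an exponential turns the product over interferers into a sum over points,
as the Laplace functional requires. -/
lemma negExp_neg_log_interfererFactor (ha : 0 ≤ a) (hb : 0 ≤ b) (hw : 0 ≤ w) (hΔ : 0 < Δ) :
    negExp (ENNReal.ofReal (-Real.log (interfererFactor a b Δ w)))
      = ENNReal.ofReal (interfererFactor a b Δ w) := by
  have h0 := interfererFactor_pos ha hb hw hΔ
  rw [negExp_ofReal, neg_neg, Real.exp_log h0]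
  simpa using Real.log_nonpos h0.le (interfererFactor_le_one ha hb hw hΔ)

end Factor

/-- Up to the factor `1 / (1 + c)`, the integrand times the density of rate `r` is the density of
rate `r * (1 + c)`, which has mass one. -/
lemma lintegral_negExp_expMeasure {r c : ℝ} (hr : 0 < r) (hc : 0 ≤ c) :
    ∫⁻ x, negExp (ENNReal.ofReal r * (ENNReal.ofReal c * ENNReal.ofReal x)) ∂(expMeasure r)
      = ENNReal.ofReal (1 / (1 + c)) := by
  have hrc : 0 < r * (1 + c) := by positivity
  have := isProbabilityMeasure_expMeasure hrc
  have h1 := lintegral_expMeasure (r * (1 + c)) (fun _ => 1) measurable_const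
  rw [lintegral_const, measure_univ, one_mul] at h1
  rw [lintegral_expMeasure _ _ (by fun_prop), ← mul_one (ENNReal.ofReal (1 / (1 + c))), h1,
    ← lintegral_const_mul _ (by fun_prop)]
  refine setLIntegral_congr_fun measurableSet_Ioi fun v (hv : 0 < v) => ?_
  simp only [mul_one]
  rw [← ENNReal.ofReal_mul hc, ← ENNReal.ofReal_mul hr.le, negExp_ofReal (by positivity),
    ← ENNReal.ofReal_mul (by positivity), ← ENNReal.ofReal_mul (by positivity)]
  have h2 : Real.exp (-(r * v)) * Real.exp (-(r * (c * v))) = Real.exp (-(r * (1 + c) * v)) := by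
    rw [← Real.exp_add]; congr 1; ring
  rw [mul_assoc, h2]
  congr 1
  field_simp

/-! ### Averaging over the marks with the locations fixed. -/

/-- The law of the marks of a base station. -/
noncomputable abbrev markLaw (mu : ℝ) (Δ : ℕ) : Measure (ℝ × ℝ × Fin Δ) :=
  (expMeasure mu).prod ((expMeasure mu).prod (uniformOn (Set.univ : Set (Fin Δ))))

lemma lintegral_uniformOn_univ {Δ : ℕ} (f : Fin Δ → ℝ≥0∞) :
    ∫⁻ d, f d ∂(uniformOn (Set.univ : Set (Fin Δ))) = ∑ d, f d * (Δ : ℝ≥0∞)⁻¹ := by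
  rw [lintegral_fintype]
  refine Finset.sum_congr rfl fun d _ => ?_
  rw [uniformOn_univ, Measure.count_singleton, Fintype.card_fin, one_div]

section MarkLaw

variable {mu : ℝ} {Δ : ℕ}

/-- For the serving station: the edge threshold `B` depends on its own sub-band, because that
decides who interferes. -/
lemma markLaw_le_and_le (hmu : 0 < mu) (hΔ : 0 < Δ) (A : ℝ≥0∞) (B : Fin Δ → ℝ≥0∞) :
    markLaw mu Δ {m | A ≤ ENNReal.ofReal m.1 ∧ B m.2.2 ≤ ENNReal.ofReal m.2.1}
      = ∑ d, negExp (ENNReal.ofReal mu * (A + B d)) * (Δ : ℝ≥0∞)⁻¹ := by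
  have := isProbabilityMeasure_expMeasure hmu
  have : NeZero Δ := ⟨hΔ.ne'⟩
  have h1 : {m : ℝ × ℝ × Fin Δ | A ≤ ENNReal.ofReal m.1 ∧ B m.2.2 ≤ ENNReal.ofReal m.2.1}
      = {x | A ≤ ENNReal.ofReal x} ×ˢ {p : ℝ × Fin Δ | B p.2 ≤ ENNReal.ofReal p.1} := rfl
  have hm : MeasurableSet {p : ℝ × Fin Δ | B p.2 ≤ ENNReal.ofReal p.1} :=
    measurableSet_le (Measurable.of_discrete.comp measurable_snd) (by fun_prop)
  rw [h1, Measure.prod_prod, expMeasure_ofReal_le hmu, Measure.prod_apply_symm hm,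
    lintegral_uniformOn_univ, Finset.mul_sum]
  refine Finset.sum_congr rfl fun d _ => ?_
  rw [mul_add, negExp_add, mul_assoc]
  congr 2
  exact expMeasure_ofReal_le hmu (B d)

/-- For an interferer: its common fading gives `1 / (1 + a)`; its edge fading gives `1 / (1 + b)` if
it uses the sub-band `d`, with probability `1 / Δ`, and `1` otherwise. The result does not depend on
`d`. -/
lemma lintegral_negExp_markLaw (hmu : 0 < mu) {a b : ℝ} (ha : 0 ≤ a) (hb : 0 ≤ b) (d : Fin Δ) :
    ∫⁻ m, negExp (ENNReal.ofReal mu * (ENNReal.ofReal a * ENNReal.ofReal m.1 +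
        ENNReal.ofReal b * (if m.2.2 = d then ENNReal.ofReal m.2.1 else 0))) ∂(markLaw mu Δ)
      = ENNReal.ofReal (interfererFactor a b Δ 1) := by
  have hΔ : 0 < Δ := d.pos
  have := isProbabilityMeasure_expMeasure hmu
  have : NeZero Δ := ⟨hΔ.ne'⟩
  have hme : Measurable fun p : ℝ × Fin Δ => negExp (ENNReal.ofReal mu *
      (ENNReal.ofReal b * (if p.2 = d then ENNReal.ofReal p.1 else 0))) := by
    have : MeasurableSet {p : ℝ × Fin Δ | p.2 = d} :=
      measurable_snd (measurableSet_singleton d)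
    exact measurable_negExp.comp (((Measurable.ite this (by fun_prop) measurable_const).const_mul _).const_mul _)
  simp_rw [mul_add, negExp_add]
  rw [lintegral_prod_mul (f := fun x => negExp (ENNReal.ofReal mu *
      (ENNReal.ofReal a * ENNReal.ofReal x))) (by fun_prop) hme.aemeasurable,
    lintegral_negExp_expMeasure hmu ha, lintegral_prod_symm _ hme.aemeasurable,
    lintegral_uniformOn_univ]
  have h1 : ∀ e : Fin Δ, ∫⁻ x, negExp (ENNReal.ofReal mu *
      (ENNReal.ofReal b * (if e = d then ENNReal.ofReal x else 0))) ∂(expMeasure mu)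
      = ENNReal.ofReal (if e = d then 1 / (1 + b) else 1) := fun e => by
    by_cases he : e = d
    · simp only [he, if_true]
      exact lintegral_negExp_expMeasure hmu hb
    · simp [he]
  simp_rw [h1]
  have hΔ' : (0 : ℝ) < Δ := by exact_mod_cast hΔ
  have h2 : ∀ e : Fin Δ, ENNReal.ofReal (if e = d then 1 / (1 + b) else 1) * (Δ : ℝ≥0∞)⁻¹
      = ENNReal.ofReal ((if e = d then 1 / (1 + b) else 1) * (Δ : ℝ)⁻¹) := fun e => by
    rw [ENNReal.ofReal_mul (by positivity), ENNReal.ofReal_inv_of_pos hΔ', ENNReal.ofReal_natCast]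
  simp_rw [h2]
  rw [← ENNReal.ofReal_sum_of_nonneg (fun e _ => by positivity), ← ENNReal.ofReal_mul (by positivity),
    ← Finset.sum_mul]
  congr 1
  have h3 : ∀ e : Fin Δ, (if e = d then 1 / (1 + b) else 1)
      = 1 - (if e = d then 1 - 1 / (1 + b) else 0) := fun e => by split_ifs <;> ring
  simp_rw [h3]
  rw [Finset.sum_sub_distrib, Finset.sum_ite_eq' Finset.univ d]
  simp only [interfererFactor, Finset.sum_const, Finset.card_univ, Fintype.card_fin, nsmul_eq_mul,
    Finset.mem_univ, if_true, mul_one]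
  field_simp

end MarkLaw

section Independence

variable {Ω : Type*} [MeasurableSpace Ω] {Pr : Measure Ω}

lemma indepFun_ne_of_iIndepFun {β : Type*} [MeasurableSpace β] {M : ℕ → Ω → β}
    (hM : ∀ n, Measurable (M n)) (hind : iIndepFun M Pr) (s : ℕ) :
    IndepFun (M s) (fun ω (n : {n : ℕ | n ≠ s}) => M n ω) Pr := by
  rw [IndepFun_iff_Indep]
  have h := indep_iSup_of_disjoint (fun n => (hM n).comap_le) hind.iIndep
    (S := {s}) (T := {n | n ≠ s}) (by simp)
  refine indep_of_indep_of_le_left (indep_of_indep_of_le_right h ?_) ?_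
  · rw [MeasurableSpace.pi, MeasurableSpace.comap_iSup]
    refine iSup_le fun n => ?_
    rw [MeasurableSpace.comap_comp]
    exact le_iSup₂_of_le (n : ℕ) n.2 le_rfl
  · exact le_iSup₂_of_le s rfl le_rfl

variable [IsProbabilityMeasure Pr]

lemma lintegral_negExp_tsum_of_iIndepFun {Y : ℕ → Ω → ℝ≥0∞} (hY : ∀ n, Measurable (Y n))
    (hind : iIndepFun Y Pr) {c : ℕ → ℝ≥0∞} (hc : ∀ n, ∫⁻ ω, negExp (Y n ω) ∂Pr = negExp (c n)) :
    ∫⁻ ω, negExp (∑' n, Y n ω) ∂Pr = negExp (∑' n, c n) := by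
  have h1 : Tendsto (fun N => ∫⁻ ω, negExp (∑ n ∈ Finset.range N, Y n ω) ∂Pr) atTop
      (𝓝 (∫⁻ ω, negExp (∑' n, Y n ω) ∂Pr)) := by
    refine tendsto_lintegral_of_dominated_convergence (fun _ => 1) (fun N => ?_)
      (fun N => Eventually.of_forall fun ω => negExp_le_one _) (by simp) ?_
    · exact measurable_negExp.comp (Finset.measurable_fun_sum _ fun n _ => hY n)
    · exact Eventually.of_forall fun ω => (continuous_negExp.tendsto _).comp
        (ENNReal.tendsto_nat_tsum _)
  refine tendsto_nhds_unique h1 (((continuous_negExp.tendsto _).comp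
    (ENNReal.tendsto_nat_tsum c)).congr fun N => ?_)
  simp only [Function.comp_apply, negExp_sum]
  rw [lintegral_prod_eq_prod_lintegral_of_indepFun _ (fun n ω => negExp (Y n ω))
    (hind.comp (fun _ => negExp) fun _ => measurable_negExp) fun n => measurable_negExp.comp (hY n)]
  exact Finset.prod_congr rfl fun n _ => (hc n).symm

lemma measure_le_and_le_of_indepFun {mu : ℝ} {Δ : ℕ} (hmu : 0 < mu) (hΔ : 0 < Δ)
    {β : Type*} [MeasurableSpace β] {m : Ω → ℝ × ℝ × Fin Δ} {U : Ω → β} (hm : Measurable m)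
    (hU : Measurable U) (hind : IndepFun m U Pr) (hlaw : Pr.map m = markLaw mu Δ)
    {A : β → ℝ≥0∞} {B : Fin Δ → β → ℝ≥0∞} (hA : Measurable A) (hB : ∀ d, Measurable (B d)) :
    Pr {ω | A (U ω) ≤ ENNReal.ofReal (m ω).1 ∧ B (m ω).2.2 (U ω) ≤ ENNReal.ofReal (m ω).2.1}
      = ∑ d, (∫⁻ ω, negExp (ENNReal.ofReal mu * (A (U ω) + B d (U ω))) ∂Pr) * (Δ : ℝ≥0∞)⁻¹ := by
  have := isProbabilityMeasure_expMeasure hmu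
  have : NeZero Δ := ⟨hΔ.ne'⟩
  have := Measure.isProbabilityMeasure_map (μ := Pr) hU.aemeasurable
  let E : Set ((ℝ × ℝ × Fin Δ) × β) :=
    {p | A p.2 ≤ ENNReal.ofReal p.1.1 ∧ B p.1.2.2 p.2 ≤ ENNReal.ofReal p.1.2.1}
  have hE : MeasurableSet E := by
    have hB' : Measurable fun p : Fin Δ × β => B p.1 p.2 := measurable_from_prod_countable_right hB
    have h1 : Measurable fun p : (ℝ × ℝ × Fin Δ) × β => B p.1.2.2 p.2 :=
      hB'.comp (Measurable.prodMk (by fun_prop) measurable_snd)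
    exact (measurableSet_le (hA.comp measurable_snd) (by fun_prop)).inter
      (measurableSet_le h1 (by fun_prop))
  have h1 : Pr {ω | A (U ω) ≤ ENNReal.ofReal (m ω).1 ∧ B (m ω).2.2 (U ω) ≤ ENNReal.ofReal (m ω).2.1}
      = Pr.map (fun ω => (m ω, U ω)) E := by
    rw [Measure.map_apply (hm.prodMk hU) hE]; rfl
  have hmeas : ∀ d, Measurable fun u => negExp (ENNReal.ofReal mu * (A u + B d u)) := fun d =>
    measurable_negExp.comp ((hA.add (hB d)).const_mul _)
  rw [h1, (indepFun_iff_map_prod_eq_prod_map_map hm.aemeasurable hU.aemeasurable).1 hind, hlaw,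
    Measure.prod_apply_symm hE]
  refine (lintegral_congr fun u => markLaw_le_and_le hmu hΔ (A u) (fun d => B d u)).trans ?_
  rw [lintegral_finsetSum _ fun d _ => (hmeas d).mul_const _]
  refine Finset.sum_congr rfl fun d _ => ?_
  rw [lintegral_mul_const _ (hmeas d), lintegral_map (hmeas d) hU]

/-- The joint coverage probability on both sub-bands for given locations of the base stations. -/
theorem measure_covered_of_marks {mu : ℝ} {Δ : ℕ} (hmu : 0 < mu) (hΔ : 0 < Δ)
    {M : ℕ → Ω → ℝ × ℝ × Fin Δ} (hM : ∀ n, Measurable (M n)) (hind : iIndepFun M Pr)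
    (hlaw : ∀ n, Pr.map (M n) = markLaw mu Δ) {a b : ℝ} (ha : 0 ≤ a) (hb : 0 ≤ b) {w : ℕ → ℝ}
    (hw : ∀ n, 0 ≤ w n) {s : ℕ} (hs : w s = 0) (ca cb : ℝ≥0∞) :
    Pr {ω | ca + ∑' n, ENNReal.ofReal (a * w n) * ENNReal.ofReal (M n ω).1
          ≤ ENNReal.ofReal (M s ω).1 ∧
        cb + ∑' n, ENNReal.ofReal (b * w n) *
            (if (M n ω).2.2 = (M s ω).2.2 then ENNReal.ofReal (M n ω).2.1 else 0)
          ≤ ENNReal.ofReal (M s ω).2.1}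
      = negExp (ENNReal.ofReal mu * (ca + cb) +
          ∑' n, ENNReal.ofReal (-Real.log (interfererFactor a b Δ (w n)))) := by
  let U : Ω → {n : ℕ | n ≠ s} → ℝ × ℝ × Fin Δ := fun ω n => M n ω
  have hU : Measurable U := measurable_pi_lambda _ fun n => hM n
  let A : ({n : ℕ | n ≠ s} → ℝ × ℝ × Fin Δ) → ℝ≥0∞ := fun u =>
    ca + ∑' n : {n : ℕ | n ≠ s}, ENNReal.ofReal (a * w n) * ENNReal.ofReal (u n).1
  let B : Fin Δ → ({n : ℕ | n ≠ s} → ℝ × ℝ × Fin Δ) → ℝ≥0∞ := fun d u =>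
    cb + ∑' n : {n : ℕ | n ≠ s}, ENNReal.ofReal (b * w n) *
      (if (u n).2.2 = d then ENNReal.ofReal (u n).2.1 else 0)
  have hite : ∀ d : Fin Δ, Measurable fun m : ℝ × ℝ × Fin Δ =>
      if m.2.2 = d then ENNReal.ofReal m.2.1 else 0 := fun d =>
    Measurable.ite (measurable_snd.snd (measurableSet_singleton d)) (by fun_prop) measurable_const
  have hA : Measurable A := measurable_const.add (Measurable.tsum fun n =>
    (measurable_pi_apply n).fst.ennreal_ofReal.const_mul _)
  have hB : ∀ d, Measurable (B d) := fun d => measurable_const.add (Measurable.tsum fun n =>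
    ((hite d).comp (measurable_pi_apply n)).const_mul _)
  -- Since `w s = 0`, the serving station drops out of the sums, so both thresholds are functions of
  -- the other marks, which are independent of `M s`.
  have hsub : ∀ f : ℕ → ℝ≥0∞, f s = 0 → ∑' n, f n = ∑' n : {n : ℕ | n ≠ s}, f n := fun f hf =>
    (tsum_subtype_eq_of_support_subset (s := {n : ℕ | n ≠ s}) fun n hn (hns : n = s) =>
      hn (by rw [hns, hf])).symm
  have hAU : ∀ ω, A (U ω) = ca + ∑' n, ENNReal.ofReal (a * w n) * ENNReal.ofReal (M n ω).1 :=
    fun ω => by rw [hsub _ (by simp [hs])]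
  have hBU : ∀ d ω, B d (U ω) = cb + ∑' n, ENNReal.ofReal (b * w n) *
      (if (M n ω).2.2 = d then ENNReal.ofReal (M n ω).2.1 else 0) :=
    fun d ω => by rw [hsub _ (by simp [hs])]
  have key := measure_le_and_le_of_indepFun hmu hΔ (hM s) hU (indepFun_ne_of_iIndepFun hM hind s)
    (hlaw s) hA hB
  simp_rw [hAU, hBU] at key
  rw [key]
  have hd : ∀ d : Fin Δ, ∫⁻ ω, negExp (ENNReal.ofReal mu *
      ((ca + ∑' n, ENNReal.ofReal (a * w n) * ENNReal.ofReal (M n ω).1) +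
        (cb + ∑' n, ENNReal.ofReal (b * w n) *
          (if (M n ω).2.2 = d then ENNReal.ofReal (M n ω).2.1 else 0)))) ∂Pr
      = negExp (ENNReal.ofReal mu * (ca + cb) +
          ∑' n, ENNReal.ofReal (-Real.log (interfererFactor a b Δ (w n)))) := fun d => by
    let G : ℕ → ℝ × ℝ × Fin Δ → ℝ≥0∞ := fun n m => ENNReal.ofReal mu *
      (ENNReal.ofReal (a * w n) * ENNReal.ofReal m.1 +
        ENNReal.ofReal (b * w n) * (if m.2.2 = d then ENNReal.ofReal m.2.1 else 0))
    have hG : ∀ n, Measurable (G n) := fun n =>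
      ((measurable_fst.ennreal_ofReal.const_mul _).add ((hite d).const_mul _)).const_mul _
    have hc : ∀ n, ∫⁻ ω, negExp (G n (M n ω)) ∂Pr
        = negExp (ENNReal.ofReal (-Real.log (interfererFactor a b Δ (w n)))) := fun n => by
      rw [← lintegral_map (f := fun m => negExp (G n m)) (measurable_negExp.comp (hG n)) (hM n),
        hlaw n, lintegral_negExp_markLaw hmu (mul_nonneg ha (hw n)) (mul_nonneg hb (hw n)) d,
        negExp_neg_log_interfererFactor ha hb (hw n) hΔ]
      simp [interfererFactor]
    have := lintegral_negExp_tsum_of_iIndepFun (fun n => (hG n).comp (hM n)) (hind.comp G hG) hc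
    have hmeas : Measurable fun ω => negExp (∑' n, (G n ∘ M n) ω) :=
      measurable_negExp.comp (Measurable.tsum fun n => (hG n).comp (hM n))
    rw [negExp_add, ← this, ← lintegral_const_mul _ hmeas]
    refine lintegral_congr fun ω => ?_
    rw [← negExp_add]
    congr 1
    simp only [Function.comp_apply, G]
    rw [ENNReal.tsum_mul_left, ENNReal.tsum_add]
    ring
  -- All `Δ` sub-bands contribute equally, which cancels the uniform weight.
  rw [Finset.sum_congr rfl fun d _ => by rw [hd d]]
  rw [Finset.sum_const, Finset.card_univ, Fintype.card_fin, nsmul_eq_mul, mul_left_comm,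
    ENNReal.mul_inv_cancel (by exact_mod_cast hΔ.ne') (by simp), mul_one]

/-- Fubini; it allows the locations to be frozen while only the marks are random. -/
lemma measure_prodMk_mem_of_indepFun {β γ : Type*} [MeasurableSpace β] [MeasurableSpace γ]
    {X : Ω → β} {Y : Ω → γ} (hX : Measurable X) (hY : Measurable Y) (hind : IndepFun X Y Pr)
    {E : Set (β × γ)} (hE : MeasurableSet E) :
    Pr {ω | (X ω, Y ω) ∈ E} = ∫⁻ ω, Pr {ω' | (X ω, Y ω') ∈ E} ∂Pr := by
  have := Measure.isProbabilityMeasure_map (μ := Pr) hY.aemeasurable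
  have h1 : Pr {ω | (X ω, Y ω) ∈ E} = Pr.map (fun ω => (X ω, Y ω)) E := by
    rw [Measure.map_apply (hX.prodMk hY) hE]; rfl
  rw [h1, (indepFun_iff_map_prod_eq_prod_map_map hX.aemeasurable hY.aemeasurable).1 hind,
    Measure.prod_apply hE, lintegral_map (measurable_measure_prodMk_left hE) hX]
  refine lintegral_congr fun ω => ?_
  rw [Measure.map_apply hY (measurable_prodMk_left hE)]
  rfl

end Independence

/-! ### Bounds on `ξ` and its geometric meaning. -/

section Xi

variable {a b α : ℝ} {Δ : ℕ}

lemma xi_eq_integral (a b α : ℝ) (Δ : ℕ) :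
    xi b a α Δ = ∫ x in Set.Ioi (1 : ℝ), (1 - interfererFactor a b Δ (x ^ (-α))) * x := rfl

lemma one_sub_interfererFactor_nonneg (ha : 0 ≤ a) (hb : 0 ≤ b) (hΔ : 0 < Δ) {w : ℝ} (hw : 0 ≤ w) :
    0 ≤ 1 - interfererFactor a b Δ w :=
  sub_nonneg.2 (interfererFactor_le_one ha hb hw hΔ)

/-- Decay in `w` gives integrability of the integrand of `ξ`, as `α > 2`; linearity in the
thresholds later rules out infinite interference. -/
lemma one_sub_interfererFactor_le (ha : 0 ≤ a) (hb : 0 ≤ b) (hΔ : 0 < Δ) {w : ℝ} (hw : 0 ≤ w) :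
    1 - interfererFactor a b Δ w ≤ (a + b) * w := by
  have hΔ' : (1 : ℝ) ≤ Δ := by exact_mod_cast hΔ
  have hdiv : ∀ c : ℝ, 0 ≤ c → 1 - 1 / (1 + c) ≤ c ∧ 0 ≤ 1 - 1 / (1 + c) ∧ 1 / (1 + c) ≤ 1 := fun c hc => by
    have h1 : 1 / (1 + c) * (1 + c) = 1 := by field_simp
    have h2 : 0 < 1 / (1 + c) := by positivity
    have h3 : 1 / (1 + c) ≤ 1 := by rw [div_le_one (by positivity)]; linarith
    exact ⟨by nlinarith, by linarith, h3⟩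
  obtain ⟨h1, h1', h1''⟩ := hdiv (a * w) (by positivity)
  obtain ⟨h2, h2', -⟩ := hdiv (b * w) (by positivity)
  have h3 : 1 / (Δ : ℝ) ≤ 1 := by rw [div_le_one (by positivity)]; exact hΔ'
  have h4 : 0 < 1 / (Δ : ℝ) := by positivity
  have h5 : 0 < 1 / (1 + a * w) := by positivity
  unfold interfererFactor
  set p := 1 / (1 + a * w)
  set q := 1 - 1 / (1 + b * w)
  have h6 : 1 / (Δ : ℝ) * q ≤ q := by nlinarith
  have h7 : p * (1 / (Δ : ℝ) * q) ≤ 1 / (Δ : ℝ) * q := mul_le_of_le_one_left (by positivity) h1''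
  nlinarith

lemma integrableOn_rpow_mul_self (hα : 2 < α) :
    IntegrableOn (fun x : ℝ => x ^ (-α) * x) (Set.Ioi 1) := by
  refine (integrableOn_Ioi_rpow_of_lt (a := 1 - α) (by linarith) one_pos).congr_fun (fun x hx => ?_)
    measurableSet_Ioi
  have hx0 : (0 : ℝ) < x := one_pos.trans hx
  simp only
  rw [sub_eq_neg_add, Real.rpow_add hx0, Real.rpow_one]

lemma integrableOn_xi (ha : 0 ≤ a) (hb : 0 ≤ b) (hα : 2 < α) (hΔ : 0 < Δ) :
    IntegrableOn (fun x => (1 - interfererFactor a b Δ (x ^ (-α))) * x) (Set.Ioi 1) := by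
  refine Integrable.mono' ((integrableOn_rpow_mul_self hα).const_mul (a + b)) ?_ ?_
  · exact ((measurable_const.sub (measurable_interfererFactor.comp (by fun_prop))).mul
      measurable_id).aestronglyMeasurable
  · refine (ae_restrict_mem measurableSet_Ioi).mono fun x (hx : 1 < x) => ?_
    have hx0 : (0 : ℝ) < x := one_pos.trans hx
    have hw : 0 ≤ x ^ (-α) := by positivity
    rw [Real.norm_of_nonneg (mul_nonneg (one_sub_interfererFactor_nonneg ha hb hΔ hw) hx0.le),
      ← mul_assoc]
    exact mul_le_mul_of_nonneg_right (one_sub_interfererFactor_le ha hb hΔ hw) hx0.le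

lemma xi_nonneg (ha : 0 ≤ a) (hb : 0 ≤ b) (hΔ : 0 < Δ) : 0 ≤ xi b a α Δ := by
  rw [xi_eq_integral]
  refine setIntegral_nonneg measurableSet_Ioi fun x (hx : 1 < x) => ?_
  have hx0 : (0 : ℝ) < x := one_pos.trans hx
  exact mul_nonneg (one_sub_interfererFactor_nonneg ha hb hΔ (by positivity)) hx0.le

lemma xi_le (ha : 0 ≤ a) (hb : 0 ≤ b) (hα : 2 < α) (hΔ : 0 < Δ) :
    xi b a α Δ ≤ (a + b) * ∫ x in Set.Ioi (1 : ℝ), x ^ (-α) * x := by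
  rw [xi_eq_integral, ← integral_const_mul]
  refine setIntegral_mono_on (integrableOn_xi ha hb hα hΔ)
    ((integrableOn_rpow_mul_self hα).const_mul (a + b)) measurableSet_Ioi fun x (hx : 1 < x) => ?_
  have hx0 : (0 : ℝ) < x := one_pos.trans hx
  rw [← mul_assoc]
  exact mul_le_mul_of_nonneg_right (one_sub_interfererFactor_le ha hb hΔ (by positivity)) hx0.le

/-- On `(1, R]` the factor is at most its distance-`1` analogue in loss: `1 - interfererFactor`
decreases in `x`, so it is bounded below by its value at `R`, and `x` integrates to `(R ^ 2 - 1) /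
2`. -/
lemma le_xi (ha : 0 ≤ a) (hb : 0 ≤ b) (hα : 2 < α) (hΔ : 0 < Δ) {R : ℝ} (hR : 1 ≤ R) :
    (1 - interfererFactor a b Δ (R ^ (-α))) * ((R ^ 2 - 1) / 2) ≤ xi b a α Δ := by
  have h1 : ∫ x in Set.Ioc 1 R, (1 - interfererFactor a b Δ (R ^ (-α))) * x
      = (1 - interfererFactor a b Δ (R ^ (-α))) * ((R ^ 2 - 1) / 2) := by
    rw [← intervalIntegral.integral_of_le hR, intervalIntegral.integral_const_mul, integral_id]
    ring
  rw [← h1, xi_eq_integral]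
  have hi := integrableOn_xi ha hb hα hΔ
  refine (setIntegral_mono_on ?_ (hi.mono_set Set.Ioc_subset_Ioi_self) measurableSet_Ioc
    fun x hx => ?_).trans (setIntegral_mono_set hi ?_ Set.Ioc_subset_Ioi_self.eventuallyLE)
  · exact ((continuous_const.mul continuous_id).integrableOn_Icc).mono_set Set.Ioc_subset_Icc_self
  · have hx0 : 0 < x := one_pos.trans hx.1
    refine mul_le_mul_of_nonneg_right (sub_le_sub_left ?_ 1) hx0.le
    have hR0 : 0 < R := hx0.trans_le hx.2
    refine interfererFactor_antitoneOn ha hb hΔ (Set.mem_Ici.2 (by positivity))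
      (Set.mem_Ici.2 (by positivity)) ?_
    exact Real.rpow_le_rpow_of_nonpos hx0 hx.2 (by linarith)
  · refine (ae_restrict_mem measurableSet_Ioi).mono fun x (hx : 1 < x) => ?_
    have hx0 : (0 : ℝ) < x := one_pos.trans hx
    exact mul_nonneg (one_sub_interfererFactor_nonneg ha hb hΔ (by positivity)) hx0.le

lemma interfererFactor_lt_one_of_common (ha : 0 < a) (hb : 0 ≤ b) (hΔ : 0 < Δ) {w : ℝ} (hw : 0 < w) :
    interfererFactor a b Δ w < 1 := by
  obtain ⟨h1, h2⟩ := edgeFactor_mem hb hw.le hΔ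
  refine mul_lt_one_of_nonneg_of_lt_one_left (by positivity) ?_ h2
  rw [div_lt_one (by positivity)]
  nlinarith [mul_pos ha hw]

lemma xi_pos (ha : 0 < a) (hb : 0 ≤ b) (hα : 2 < α) (hΔ : 0 < Δ) : 0 < xi b a α Δ := by
  refine lt_of_lt_of_le ?_ (le_xi ha.le hb hα hΔ (R := 2) one_le_two)
  have : interfererFactor a b Δ (2 ^ (-α)) < 1 :=
    interfererFactor_lt_one_of_common ha hb hΔ (by positivity)
  refine mul_pos (by linarith) (by norm_num)

/-- Take `R = c ^ (1 / α)` in `le_xi`: the path loss at `R` is `1 / c`, so the sub-band with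
threshold `c` has factor `1 / 2`, and the loss is at least `1 / (2 Δ)` on either sub-band. -/
lemma le_xi_of_one_le {c : ℝ} (hc : 1 ≤ c) (ha : 0 ≤ a) (hb : 0 ≤ b) (hcab : c = a ∨ c = b)
    (hα : 2 < α) (hΔ : 0 < Δ) : (c ^ (2 / α) - 1) / (4 * Δ) ≤ xi b a α Δ := by
  have hc0 : 0 < c := one_pos.trans_le hc
  have hΔ' : (1 : ℝ) ≤ Δ := by exact_mod_cast hΔ
  have hR : 1 ≤ c ^ (1 / α) := Real.one_le_rpow hc (by positivity)
  refine le_trans ?_ (le_xi ha hb hα hΔ hR)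
  have h1 : (c ^ (1 / α)) ^ (-α) = 1 / c := by
    rw [← Real.rpow_mul hc0.le, mul_neg, one_div_mul_cancel (by linarith), Real.rpow_neg_one, one_div]
  have h2 : (c ^ (1 / α)) ^ 2 = c ^ (2 / α) := by
    rw [← Real.rpow_natCast, ← Real.rpow_mul hc0.le]; congr 1; push_cast; ring
  have h3 : 0 < 1 / (Δ : ℝ) := by positivity
  have h4 : 1 / (Δ : ℝ) ≤ 1 := by rw [div_le_one (by positivity)]; exact hΔ'
  have h5 : 1 / (Δ : ℝ) / 2 ≤ 1 - interfererFactor a b Δ (1 / c) := by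
    have hw : 0 ≤ 1 / c := by positivity
    rcases hcab with rfl | rfl
    · have h6 : interfererFactor c b Δ (1 / c) ≤ 1 / 2 := by
        unfold interfererFactor
        rw [mul_one_div_cancel hc0.ne']
        nlinarith [(edgeFactor_mem hb hw hΔ).2]
      linarith
    · have h6 : interfererFactor a c Δ (1 / c) ≤ 1 - 1 / (Δ : ℝ) * (1 / 2) := by
        have h7 := edgeFactor_mem hb hw hΔ
        have h8 : 1 / (1 + a * (1 / c)) ≤ 1 := by
          rw [div_le_one (by positivity)]
          nlinarith [mul_nonneg ha hw]
        unfold interfererFactor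
        refine (mul_le_of_le_one_left h7.1.le h8).trans (le_of_eq ?_)
        rw [mul_one_div_cancel hc0.ne']
        ring
      linarith
  rw [h1, h2]
  have h9 : 0 ≤ c ^ (2 / α) - 1 := sub_nonneg.2 (Real.one_le_rpow hc (by positivity))
  calc (c ^ (2 / α) - 1) / (4 * Δ) = 1 / (Δ : ℝ) / 2 * ((c ^ (2 / α) - 1) / 2) := by
        field_simp; ring
    _ ≤ _ := by gcongr

/-- The integral over the region outside a disc in terms of `ξ`. -/
lemma lintegral_one_sub_interfererFactor (ha : 0 ≤ a) (hb : 0 ≤ b) (hα : 2 < α) (hΔ : 0 < Δ) {v : ℝ}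
    (hv : 0 < v) :
    ∫⁻ y : Plane, {y : Plane | v < ‖y‖ ^ 2}.indicator
        (fun y => 1 - ENNReal.ofReal (interfererFactor a b Δ (v ^ (α / 2) * ‖y‖ ^ (-α)))) y
      = ENNReal.ofReal (2 * Real.pi * v * xi b a α Δ) := by
  set r := √v with hr
  have hr0 : 0 < r := Real.sqrt_pos.2 hv
  have hrv : r ^ 2 = v := Real.sq_sqrt hv.le
  let k : ℝ → ℝ := fun x => 1 - interfererFactor a b Δ (v ^ (α / 2) * x ^ (-α))
  let G : ℝ → ℝ := (Set.Ioi r).indicator k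
  have hk0 : ∀ x : ℝ, 0 ≤ x → 0 ≤ k x := fun x hx =>
    one_sub_interfererFactor_nonneg ha hb hΔ (by positivity)
  -- Measuring distances in units of `r = √v` cancels `v ^ (α / 2)` and leaves the integrand of `ξ`.
  have hscale : ∀ x ∈ Set.Ioi (1 : ℝ), (r * x) * k (r * x)
      = r * ((1 - interfererFactor a b Δ (x ^ (-α))) * x) := by
    intro x hx
    have hx0 : (0 : ℝ) < x := one_pos.trans hx
    have : v ^ (α / 2) * (r * x) ^ (-α) = x ^ (-α) := by
      rw [Real.mul_rpow hr0.le hx0.le, ← mul_assoc, ← hrv, ← Real.rpow_natCast, ← Real.rpow_mul hr0.le,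
        ← Real.rpow_add hr0]
      rw [show ((2 : ℕ) : ℝ) * (α / 2) + -α = 0 by push_cast; ring, Real.rpow_zero, one_mul]
    simp only [k, this]
    ring
  have hset : ∀ f : ℝ → ℝ, ∫ x in Set.Ioi (0 : ℝ), (Set.Ioi r).indicator f x = ∫ x in Set.Ioi r, f x :=
    fun f => by
      rw [setIntegral_indicator measurableSet_Ioi, Set.Ioi_inter_Ioi, sup_of_le_right hr0.le]
  have hind : (fun x : ℝ => x ^ (Module.finrank ℝ Plane - 1) • G x)
      = (Set.Ioi r).indicator fun x => x * k x := by
    ext x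
    by_cases hx : x ∈ Set.Ioi r <;> simp [G, hx]
  have hint : IntegrableOn (fun x => x * k x) (Set.Ioi r) := by
    have := (integrableOn_Ioi_comp_mul_left_iff (fun x => x * k x) 1 hr0).1
      (IntegrableOn.congr_fun ((integrableOn_xi ha hb hα hΔ).const_mul r)
        (fun x hx => (hscale x hx).symm) measurableSet_Ioi)
    rwa [mul_one] at this
  have hGint : Integrable (fun y : Plane => G ‖y‖) := by
    rw [integrable_fun_norm_addHaar volume, hind]
    exact ((integrable_indicator_iff measurableSet_Ioi).2 hint).integrableOn
  -- In polar coordinates the dimension `2` times the area `π` of the unit disc gives `2 π`.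
  have hval : ∫ y : Plane, G ‖y‖ = 2 * Real.pi * v * xi b a α Δ := by
    rw [integral_fun_norm_addHaar volume, hind, hset]
    have h1 := integral_comp_mul_left_Ioi (fun x => x * k x) 1 hr0
    rw [setIntegral_congr_fun measurableSet_Ioi hscale, integral_const_mul, ← xi_eq_integral, mul_one,
      smul_eq_mul] at h1
    have h2 : ∫ x in Set.Ioi r, x * k x = v * xi b a α Δ := by
      rw [← hrv, sq, mul_assoc, h1, ← mul_assoc, mul_inv_cancel₀ hr0.ne', one_mul]
    have h3 : (volume : Measure Plane).real (Metric.ball 0 1) = Real.pi := by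
      rw [Measure.real, EuclideanSpace.volume_ball_fin_two]
      simp [Real.pi_pos.le]
    rw [h2, h3]
    simp
    ring
  rw [← hval, ofReal_integral_eq_lintegral_ofReal hGint]
  · refine lintegral_congr fun y => ?_
    have hiff : v < ‖y‖ ^ 2 ↔ ‖y‖ ∈ Set.Ioi r := by
      have h := sq_lt_sq₀ hr0.le (norm_nonneg y)
      rwa [hrv] at h
    by_cases hy : v < ‖y‖ ^ 2
    · rw [Set.indicator_of_mem (by exact hy)]
      simp only [G]
      rw [Set.indicator_of_mem (hiff.1 hy), ENNReal.ofReal_sub _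
        (interfererFactor_pos ha hb (by positivity) hΔ).le, ENNReal.ofReal_one]
    · rw [Set.indicator_of_notMem (by exact hy)]
      simp only [G]
      rw [Set.indicator_of_notMem (fun h => hy (hiff.2 h)), ENNReal.ofReal_zero]
  · exact Eventually.of_forall fun y => Set.indicator_nonneg
      (fun x (hx : r < x) => hk0 x (hr0.trans hx).le) _

end Xi

/-! ### The integral over the serving distance. -/

section Coverage

variable {a b α P σ mu lam : ℝ} {Δ : ℕ}

lemma integrableOn_exp_coverage {κ c : ℝ} (hκ : 0 < κ) (hc : 0 ≤ c) (α : ℝ) :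
    IntegrableOn (fun v : ℝ => Real.exp (-(κ * v) - c * v ^ α)) (Set.Ioi 0) := by
  refine Integrable.mono' (integrableOn_exp_mul_Ioi (neg_lt_zero.2 hκ) 0)
    (by fun_prop) ?_
  refine (ae_restrict_mem measurableSet_Ioi).mono fun v (hv : 0 < v) => ?_
  rw [Real.norm_of_nonneg (Real.exp_pos _).le]
  refine Real.exp_le_exp.2 ?_
  have : 0 ≤ c * v ^ α := by positivity
  linarith

lemma qc_eq_integral (P σ mu b a lam α : ℝ) (Δ : ℕ) :
    qc P σ mu b a lam α Δ = Real.pi * lam * ∫ v in Set.Ioi (0 : ℝ),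
      Real.exp (-(Real.pi * lam * (1 + 2 * xi b a α Δ) * v) - mu * (b + a) * (σ ^ 2 / P) * v ^ (α / 2)) := by
  unfold qc
  congr 2
  ext v
  congr 1
  ring

lemma qc_nonneg (hlam : 0 < lam) : 0 ≤ qc P σ mu b a lam α Δ :=
  mul_nonneg (mul_pos Real.pi_pos hlam).le (integral_nonneg fun _ => (Real.exp_pos _).le)

lemma integral_exp_coverage (hlam : 0 < lam) {x : ℝ} (hx : 0 ≤ x) :
    Real.pi * lam * ∫ v in Set.Ioi (0 : ℝ), Real.exp (-(Real.pi * lam * (1 + 2 * x)) * v)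
      = 1 / (1 + 2 * x) := by
  have hpl : 0 < Real.pi * lam := mul_pos Real.pi_pos hlam
  rw [integral_exp_mul_Ioi (neg_lt_zero.2 (by positivity))]
  simp only [mul_zero, Real.exp_zero]
  field_simp

lemma qc_le (hlam : 0 < lam) (hmu : 0 < mu) (hP : 0 < P) (ha : 0 ≤ a) (hb : 0 ≤ b) (hΔ : 0 < Δ) :
    qc P σ mu b a lam α Δ ≤ 1 / (1 + 2 * xi b a α Δ) := by
  have hpl : 0 < Real.pi * lam := mul_pos Real.pi_pos hlam
  have hxi : 0 ≤ xi b a α Δ := xi_nonneg ha hb hΔ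
  rw [qc_eq_integral, ← integral_exp_coverage hlam hxi]
  refine mul_le_mul_of_nonneg_left (setIntegral_mono_on (integrableOn_exp_coverage (by positivity)
    (by positivity) _) (integrableOn_exp_mul_Ioi (neg_lt_zero.2 (by positivity)) 0)
    measurableSet_Ioi fun v (hv : 0 < v) => ?_) hpl.le
  refine Real.exp_le_exp.2 ?_
  have : 0 ≤ mu * (b + a) * (σ ^ 2 / P) * v ^ (α / 2) := by positivity
  linarith

lemma qc_zero_noise (hlam : 0 < lam) (ha : 0 ≤ a) (hb : 0 ≤ b) (hΔ : 0 < Δ) :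
    qc P 0 mu b a lam α Δ = 1 / (1 + 2 * xi b a α Δ) := by
  rw [qc_eq_integral, ← integral_exp_coverage hlam (xi_nonneg ha hb hΔ)]
  simp

/-- The density of `v` and the interference give `exp (-π λ v)` and `exp (-λ * 2 π v ξ)`, whose
exponents combine into `π λ (1 + 2 ξ) v`. -/
lemma lintegral_coverage (hlam : 0 < lam) (hmu : 0 < mu) (hP : 0 < P) (ha : 0 ≤ a) (hb : 0 ≤ b)
    (hα : 2 < α) (hΔ : 0 < Δ) :
    ∫⁻ v in Set.Ioi (0 : ℝ), ENNReal.ofReal (Real.pi * lam * Real.exp (-(Real.pi * lam * v))) *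
      (negExp (ENNReal.ofReal (mu * (b + a) * (σ ^ 2 / P) * v ^ (α / 2))) *
        negExp (ENNReal.ofReal lam * ∫⁻ y : Plane, {y : Plane | v < ‖y‖ ^ 2}.indicator
          (fun y => 1 - ENNReal.ofReal (interfererFactor a b Δ (v ^ (α / 2) * ‖y‖ ^ (-α)))) y))
      = ENNReal.ofReal (qc P σ mu b a lam α Δ) := by
  have hpl : 0 < Real.pi * lam := mul_pos Real.pi_pos hlam
  have hxi : 0 ≤ xi b a α Δ := xi_nonneg ha hb hΔ
  rw [qc_eq_integral, ENNReal.ofReal_mul hpl.le, ofReal_integral_eq_lintegral_ofReal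
    (integrableOn_exp_coverage (by positivity) (by positivity) _)
    (Eventually.of_forall fun _ => (Real.exp_pos _).le), ← lintegral_const_mul _ (by fun_prop)]
  refine setLIntegral_congr_fun measurableSet_Ioi fun v (hv : 0 < v) => ?_
  rw [lintegral_one_sub_interfererFactor ha hb hα hΔ hv, ← ENNReal.ofReal_mul hlam.le,
    negExp_ofReal (by positivity), negExp_ofReal (by positivity), ← ENNReal.ofReal_mul (by positivity),
    ← ENNReal.ofReal_mul (by positivity), ← ENNReal.ofReal_mul (by positivity)]
  congr 1
  rw [mul_assoc, ← Real.exp_add, ← Real.exp_add]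
  congr 2
  ring

end Coverage

/-! ### Coverage of a single sub-band and `ρ`. -/

section Rho

variable {T α : ℝ}

/-- Substitute `u = T ^ (-2 / α) * x ^ 2`; then `u ^ (α / 2) = x ^ α / T`, and `1 / (1 + x ^ α / T)
= 1 - 1 / (1 + T * x ^ (-α))`. -/
lemma rho_eq_integral (hT : 0 < T) (hα : 2 < α) :
    rho T α = 2 * ∫ x in Set.Ioi (1 : ℝ), (1 - 1 / (1 + T * x ^ (-α))) * x := by
  have hα0 : α ≠ 0 := by linarith
  have hb : 0 < T ^ (-2 / α) := by positivity
  let h : ℝ → ℝ := fun u => 1 / (1 + u ^ (α / 2))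
  have h1 := integral_comp_mul_left_Ioi h 1 hb
  rw [mul_one, smul_eq_mul] at h1
  have h2 : rho T α = ∫ s in Set.Ioi (1 : ℝ), h (T ^ (-2 / α) * s) := by
    rw [h1, ← Real.rpow_neg hT.le, rho]
    congr 2
    ring
  -- The power substitution acts on `(0, ∞)`, so the restriction to `x > 1` is carried by an
  -- indicator.
  have h3 := integral_comp_rpow_Ioi ((Set.Ioi (1 : ℝ)).indicator fun s => h (T ^ (-2 / α) * s))
    (p := 2) two_ne_zero
  have hset : ∀ f : ℝ → ℝ, ∫ x in Set.Ioi (0 : ℝ), (Set.Ioi 1).indicator f x = ∫ x in Set.Ioi 1, f x :=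
    fun f => by
      rw [setIntegral_indicator measurableSet_Ioi, Set.Ioi_inter_Ioi, sup_of_le_right zero_le_one]
  rw [h2, ← hset, ← h3, ← integral_const_mul, ← hset]
  refine setIntegral_congr_fun measurableSet_Ioi fun x (hx : 0 < x) => ?_
  by_cases hx1 : 1 < x
  · have hx2 : (1 : ℝ) < x ^ (2 : ℝ) := Real.one_lt_rpow hx1 two_pos
    rw [Set.indicator_of_mem (Set.mem_Ioi.2 hx2), Set.indicator_of_mem (Set.mem_Ioi.2 hx1)]
    have h4 : (T ^ (-2 / α) * x ^ (2 : ℝ)) ^ (α / 2) = T⁻¹ * x ^ α := by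
      rw [Real.mul_rpow hb.le (by positivity), ← Real.rpow_mul hT.le, ← Real.rpow_mul hx.le,
        ← Real.rpow_neg_one]
      congr 2 <;> field_simp
    simp only [h, h4, smul_eq_mul]
    have hxa : 0 < x ^ α := by positivity
    rw [Real.rpow_neg hx.le, show (2 : ℝ) - 1 = 1 by norm_num, Real.rpow_one, abs_of_pos two_pos]
    field_simp
    ring
  · have hx2 : ¬ (1 : ℝ) < x ^ (2 : ℝ) := not_lt.2 (Real.rpow_le_one hx.le (not_lt.1 hx1) two_pos.le)
    rw [Set.indicator_of_notMem (by exact hx2), Set.indicator_of_notMem (by exact hx1), smul_zero]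

lemma two_mul_xi_edge (hT : 0 < T) (hα : 2 < α) (Δ : ℕ) :
    2 * xi T 0 α Δ = 1 / (Δ : ℝ) * rho T α := by
  rw [rho_eq_integral hT hα, xi_eq_integral, mul_left_comm, ← integral_const_mul (1 / (Δ : ℝ))]
  congr 2
  ext x
  simp only [interfererFactor]
  ring

lemma two_mul_xi_common (hT : 0 < T) (hα : 2 < α) (Δ : ℕ) :
    2 * xi 0 T α Δ = rho T α := by
  rw [rho_eq_integral hT hα, xi_eq_integral]
  congr 2
  ext x
  simp only [interfererFactor]
  ring

lemma pc_eq_qc_edge (hT : 0 < T) (hα : 2 < α) (P σ mu lam : ℝ) (Δ : ℕ) :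
    pc P σ mu T lam α Δ = qc P σ mu T 0 lam α Δ := by
  rw [pc, qc, two_mul_xi_edge hT hα, add_zero]

/-- On the common sub-band every other station interferes, so the marginal is that of reuse-`1` for
any `Δ`. -/
lemma pc_one_eq_qc_common (hT : 0 < T) (hα : 2 < α) (P σ mu lam : ℝ) (Δ : ℕ) :
    pc P σ mu T lam α 1 = qc P σ mu 0 T lam α Δ := by
  rw [pc, qc, two_mul_xi_common hT hα, zero_add]
  simp

end Rho

/-! ### The coverage event and its probability. -/

section RelPathLoss

variable {Ω : Type*} {α : ℝ} {X : ℕ → Ω → Plane} {ω : Ω}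

/-- The path loss of base station `n` relative to that of the serving one, which itself gets the
value `0`. -/
noncomputable def relPathLoss (α : ℝ) (X : ℕ → Ω → Plane) (ω : Ω) (n : ℕ) : ℝ :=
  if n = serving X ω then 0 else ‖X (serving X ω) ω‖ ^ α * ‖X n ω‖ ^ (-α)

lemma relPathLoss_nonneg (n : ℕ) : 0 ≤ relPathLoss α X ω n := by
  unfold relPathLoss
  split_ifs <;> positivity

@[simp] lemma relPathLoss_serving : relPathLoss α X ω (serving X ω) = 0 := by simp [relPathLoss]

/-- The common sub-band and the edge sub-band cover the user with thresholds `a` and `b`, where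
`c` is the quotient of the noise power and the transmit power. -/
def coveredEvent {Δ : ℕ} (c α a b : ℝ) (X : ℕ → Ω → Plane) (g g' : ℕ → Ω → ℝ)
    (δ : ℕ → Ω → Fin Δ) : Set Ω :=
  {ω | ENNReal.ofReal (a * c * ‖X (serving X ω) ω‖ ^ α) +
        ∑' n, ENNReal.ofReal (a * relPathLoss α X ω n) * ENNReal.ofReal (g n ω)
        ≤ ENNReal.ofReal (g (serving X ω) ω) ∧
      ENNReal.ofReal (b * c * ‖X (serving X ω) ω‖ ^ α) +
        ∑' n, ENNReal.ofReal (b * relPathLoss α X ω n) *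
          (if δ n ω = δ (serving X ω) ω then ENNReal.ofReal (g' n ω) else 0)
        ≤ ENNReal.ofReal (g' (serving X ω) ω)}

variable [MeasurableSpace Ω]

lemma measurable_relPathLoss (hX : ∀ n, Measurable (X n)) (n : ℕ) :
    Measurable fun ω => relPathLoss α X ω n := by
  have hs := measurable_serving hX
  refine Measurable.ite (measurableSet_eq_fun measurable_const hs) measurable_const ?_
  exact ((measurable_apply_index hX hs).norm.pow_const α).mul ((hX n).norm.pow_const (-α))

lemma measurableSet_coveredEvent {Δ : ℕ} {g g' : ℕ → Ω → ℝ} {δ : ℕ → Ω → Fin Δ}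
    (hX : ∀ n, Measurable (X n)) (hg : ∀ n, Measurable (g n)) (hg' : ∀ n, Measurable (g' n))
    (hδ : ∀ n, Measurable (δ n)) (c α a b : ℝ) :
    MeasurableSet (coveredEvent c α a b X g g' δ) := by
  have hs := measurable_serving hX
  have hr : Measurable fun ω => ‖X (serving X ω) ω‖ ^ α :=
    (measurable_apply_index hX hs).norm.pow_const α
  have hδs := measurable_apply_index hδ hs
  have hite : ∀ n, Measurable fun ω =>
      if δ n ω = δ (serving X ω) ω then ENNReal.ofReal (g' n ω) else 0 := fun n => by
    have : MeasurableSet {ω | δ n ω = δ (serving X ω) ω} :=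
      ((hδ n).prodMk hδs) (MeasurableSet.of_discrete (s := {p : Fin Δ × Fin Δ | p.1 = p.2}))
    exact Measurable.ite this (hg' n).ennreal_ofReal measurable_const
  refine (measurableSet_le (Measurable.add (hr.const_mul _).ennreal_ofReal
    (Measurable.tsum fun n => ?_)) (measurable_apply_index hg hs).ennreal_ofReal).inter
    (measurableSet_le (Measurable.add (hr.const_mul _).ennreal_ofReal
    (Measurable.tsum fun n => ?_)) (measurable_apply_index hg' hs).ennreal_ofReal)
  · exact ((measurable_relPathLoss hX n).const_mul _).ennreal_ofReal.mul (hg n).ennreal_ofReal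
  · exact ((measurable_relPathLoss hX n).const_mul _).ennreal_ofReal.mul (hite n)

end RelPathLoss

section Network

variable {Ω : Type*} [MeasurableSpace Ω] {Pr : Measure Ω} [IsProbabilityMeasure Pr]
  {lam mu P σ α a b : ℝ} {Δ : ℕ} {X : ℕ → Ω → Plane} {g g' : ℕ → Ω → ℝ} {δ : ℕ → Ω → Fin Δ}

lemma IsNetwork.measure_coveredEvent_eq_lintegral (h : IsNetwork Pr lam mu Δ X g g' δ)
    (hmu : 0 < mu) (hΔ : 0 < Δ) (c α : ℝ) (ha : 0 ≤ a) (hb : 0 ≤ b) :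
    Pr (coveredEvent c α a b X g g' δ) = ∫⁻ ω, negExp (ENNReal.ofReal mu *
        (ENNReal.ofReal (a * c * ‖X (serving X ω) ω‖ ^ α) +
          ENNReal.ofReal (b * c * ‖X (serving X ω) ω‖ ^ α)) +
        ∑' n, ENNReal.ofReal (-Real.log (interfererFactor a b Δ (relPathLoss α X ω n)))) ∂Pr := by
  let M : ℕ → Ω → ℝ × ℝ × Fin Δ := fun n ω => (g n ω, g' n ω, δ n ω)
  have hM : ∀ n, Measurable (M n) := fun n =>
    (h.measurable_fading n).prodMk ((h.measurable_fading' n).prodMk (h.measurable_band n))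
  -- The same event on the canonical space of locations and marks, so that Fubini applies and its
  -- sections fall under `measure_covered_of_marks`.
  let E : Set ((ℕ → Plane) × (ℕ → ℝ × ℝ × Fin Δ)) := coveredEvent c α a b (fun n p => p.1 n)
    (fun n p => (p.2 n).1) (fun n p => (p.2 n).2.1) (fun n p => (p.2 n).2.2)
  have hE : MeasurableSet E := measurableSet_coveredEvent (fun n => by fun_prop)
    (fun n => by fun_prop) (fun n => by fun_prop) (fun n => by fun_prop) c α a b
  have key := measure_prodMk_mem_of_indepFun (measurable_pi_lambda _ h.poisson.measurable)
    (measurable_pi_lambda _ hM) h.indepFun_marks hE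
  refine Eq.trans (by rfl) (key.trans (lintegral_congr fun ω => ?_))
  refine Eq.trans (by rfl) (measure_covered_of_marks hmu hΔ hM h.iIndepFun_marks
    (fun n => (h.hasLaw_marks n).map_eq) ha hb (fun n => relPathLoss_nonneg n)
    (relPathLoss_serving (α := α) (X := X) (ω := ω))
    (ENNReal.ofReal (a * c * ‖X (serving X ω) ω‖ ^ α))
    (ENNReal.ofReal (b * c * ‖X (serving X ω) ω‖ ^ α)))

/-- The joint coverage probability on both sub-bands. -/
theorem IsNetwork.measure_coveredEvent (h : IsNetwork Pr lam mu Δ X g g' δ) (hlam : 0 < lam)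
    (hmu : 0 < mu) (hP : 0 < P) (hα : 2 < α) (hΔ : 0 < Δ) (ha : 0 ≤ a) (hb : 0 ≤ b) :
    Pr (coveredEvent (σ ^ 2 / P) α a b X g g' δ) = ENNReal.ofReal (qc P σ mu b a lam α Δ) := by
  -- The truncation `max v 0` makes `F` continuous on the whole line; only `v ≥ 0` matters.
  let F : ℝ → Plane → ℝ≥0∞ := fun v y => ENNReal.ofReal
    (-Real.log (interfererFactor a b Δ (max v 0 ^ (α / 2) * ‖y‖ ^ (-α))))
  let H : ℝ → ℝ≥0∞ := fun v => negExp (ENNReal.ofReal (mu * (b + a) * (σ ^ 2 / P) * v ^ (α / 2)))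
  have hw : ∀ (v : ℝ) (y : Plane), 0 ≤ max v 0 ^ (α / 2) * ‖y‖ ^ (-α) := fun v y => by positivity
  have hF : Measurable fun p : ℝ × Plane => F p.1 p.2 := by
    refine (Real.measurable_log.comp (measurable_interfererFactor.comp ?_)).neg.ennreal_ofReal
    fun_prop
  have hmono : ∀ y, MonotoneOn (fun v => F v y) (Set.Ici 0) := fun y v _ v' _ hvv' => by
    refine ENNReal.ofReal_le_ofReal (neg_le_neg (Real.log_le_log
      (interfererFactor_pos ha hb (hw v' y) hΔ) ?_))
    refine interfererFactor_antitoneOn ha hb hΔ (hw v y) (hw v' y) ?_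
    gcongr
  have hcont : ∀ y, Continuous fun v => F v y := fun y => by
    refine ENNReal.continuous_ofReal.comp (Continuous.neg (Continuous.log ?_ fun v =>
      (interfererFactor_pos ha hb (hw v y) hΔ).ne'))
    refine (continuousOn_interfererFactor ha hb).comp_continuous ?_ fun v => hw v y
    exact ((continuous_id.max continuous_const).rpow_const fun _ => Or.inr (by linarith)).mul_const _
  have hH : Continuous H := continuous_negExp.comp (ENNReal.continuous_ofReal.comp
    (continuous_const.mul (Real.continuous_rpow_const (by linarith))))
  have key := h.poisson.lintegral_nearest hlam hF hmono hcont hH fun v => negExp_le_one _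
  rw [h.measure_coveredEvent_eq_lintegral hmu hΔ _ _ ha hb]
  refine Eq.trans (lintegral_congr_ae ?_) (key.trans ?_)
  · filter_upwards [h.poisson.ae_nearest_nonempty, h.poisson.ae_norm_serving_pos hlam,
      h.poisson.ae_norm_injective hlam.le] with ω hne hpos hinj
    have hr : (‖X (serving X ω) ω‖ ^ 2) ^ (α / 2) = ‖X (serving X ω) ω‖ ^ α := by
      rw [← Real.rpow_natCast, ← Real.rpow_mul hpos.le]; congr 1; push_cast; ring
    rw [negExp_add]
    congr 1
    · simp only [H]
      rw [hr, ← ENNReal.ofReal_add (by positivity) (by positivity), ← ENNReal.ofReal_mul hmu.le]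
      congr 2
      ring
    · congr 2
      ext n
      by_cases hn : n = serving X ω
      · rw [hn, Set.indicator_of_notMem (by simp)]
        simp
      -- As distances are almost surely distinct, being another station means being strictly
      -- farther, which matches the strict inequality of the indicator.
      · have hlt : ‖X (serving X ω) ω‖ < ‖X n ω‖ :=
          lt_of_le_of_ne (norm_serving_le hne n) (hinj _ _ (Ne.symm hn))
        have hmem : X n ω ∈ {y : Plane | ‖X (serving X ω) ω‖ ^ 2 < ‖y‖ ^ 2} := by
          change ‖X (serving X ω) ω‖ ^ 2 < ‖X n ω‖ ^ 2
          gcongr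
        rw [Set.indicator_of_mem hmem]
        simp only [F, relPathLoss, hn, if_false]
        rw [max_eq_left (by positivity), hr]
  · rw [← lintegral_coverage hlam hmu hP ha hb hα hΔ]
    refine setLIntegral_congr_fun measurableSet_Ioi fun v (hv : 0 < v) => ?_
    simp only [H, F, max_eq_left hv.le]
    congr 5
    refine congrArg (Set.indicator _) (funext fun y => ?_)
    rw [negExp_neg_log_interfererFactor ha hb (by positivity) hΔ]

end Network

/-! ### Finiteness and positivity of the interference; the real-valued SINRs. -/

section Degenerate

variable {Ω : Type*} [MeasurableSpace Ω] {Pr : Measure Ω} [IsProbabilityMeasure Pr]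

/-- If the ratio of a signal to some interference has a suitable tail, then the interference is
neither `0` nor infinite. -/
lemma ae_ne_zero_and_ne_top_of_tail {S G : Ω → ℝ≥0∞} (hS : Measurable S) (hG : Measurable G)
    (hGt : ∀ ω, G ω ≠ ⊤) {Q : ℝ → ℝ} {C β K : ℝ} (hβ : 0 < β) (hK : 0 < K) (hQ0 : ∀ a, 0 < a → 0 ≤ Q a)
    (hQ : ∀ a, 0 < a → Pr {ω | ENNReal.ofReal a * S ω ≤ G ω} = ENNReal.ofReal (1 / (1 + 2 * Q a)))
    (hle : ∀ a, 0 < a → Q a ≤ a * C) (hge : ∀ a, 1 ≤ a → (a ^ β - 1) / K ≤ Q a) :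
    ∀ᵐ ω ∂Pr, S ω ≠ 0 ∧ S ω ≠ ⊤ := by
  have hmeas : ∀ a : ℝ, MeasurableSet {ω | ENNReal.ofReal a * S ω ≤ G ω} := fun a =>
    measurableSet_le (hS.const_mul _) hG
  have h0 : Pr {ω | S ω = 0} = 0 := by
    -- The event `S = 0` lies in every `{a S ≤ G}`, whose probability vanishes as `a → ∞`.
    have hlim : Tendsto (fun a : ℝ => ENNReal.ofReal (1 / (1 + 2 * ((a ^ β - 1) / K)))) atTop (𝓝 0) := by
      rw [← ENNReal.ofReal_zero]
      refine ENNReal.tendsto_ofReal ?_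
      simp_rw [one_div]
      refine tendsto_inv_atTop_zero.comp (tendsto_atTop_add_const_left _ _
        (Tendsto.const_mul_atTop two_pos (Tendsto.atTop_div_const hK ?_)))
      exact tendsto_atTop_add_const_right _ (-1) (tendsto_rpow_atTop hβ)
    refine le_antisymm (ge_of_tendsto hlim ?_) bot_le
    filter_upwards [eventually_ge_atTop 1] with a ha
    have ha0 : 0 < a := one_pos.trans_le ha
    calc Pr {ω | S ω = 0} ≤ Pr {ω | ENNReal.ofReal a * S ω ≤ G ω} :=
          measure_mono fun ω (hω : S ω = 0) => by
            change _ * S ω ≤ _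
            rw [hω, mul_zero]
            exact bot_le
      _ = _ := hQ a ha0
      _ ≤ _ := by
        have : 0 ≤ (a ^ β - 1) / K :=
          div_nonneg (sub_nonneg.2 (Real.one_le_rpow ha hβ.le)) hK.le
        refine ENNReal.ofReal_le_ofReal (one_div_le_one_div_of_le (by positivity) ?_)
        linarith [hge a ha]
  have h1 : Pr {ω | S ω = ⊤} = 0 := by
    -- The event `S = ⊤` misses every `{a S ≤ G}` with `a > 0`, so its probability is at most `2
    -- Q(a) ≤ 2 a C`; let `a = 1 / (n + 1) → 0`.
    have hlim : Tendsto (fun n : ℕ => ENNReal.ofReal (2 * C * (1 / ((n : ℝ) + 1)))) atTop (𝓝 0) := by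
      rw [← ENNReal.ofReal_zero]
      refine ENNReal.tendsto_ofReal ?_
      simpa only [mul_zero] using
        (tendsto_one_div_add_atTop_nhds_zero_nat (𝕜 := ℝ)).const_mul (2 * C)
    refine le_antisymm (ge_of_tendsto' hlim fun n => ?_) bot_le
    set a : ℝ := 1 / ((n : ℝ) + 1)
    have ha0 : 0 < a := by positivity
    calc Pr {ω | S ω = ⊤} ≤ Pr {ω | ENNReal.ofReal a * S ω ≤ G ω}ᶜ :=
          measure_mono fun ω (hω : S ω = ⊤) => by
            change ¬ (_ * S ω ≤ _)
            rw [hω, ENNReal.mul_top (by simpa using ha0), top_le_iff]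
            exact hGt ω
      _ = ENNReal.ofReal (1 - 1 / (1 + 2 * Q a)) := by
        have := hQ0 a ha0
        rw [prob_compl_eq_one_sub (hmeas a), hQ a ha0, ← ENNReal.ofReal_one,
          ← ENNReal.ofReal_sub _ (by positivity)]
      _ ≤ _ := by
        have h2 := hQ0 a ha0
        have h3 : 1 - 1 / (1 + 2 * Q a) ≤ 2 * Q a := by
          have h1 : 1 / (1 + 2 * Q a) * (1 + 2 * Q a) = 1 := by field_simp
          have h4 : 0 < 1 / (1 + 2 * Q a) := by positivity
          have h5 : 1 / (1 + 2 * Q a) ≤ 1 := by rw [div_le_one (by positivity)]; linarith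
          nlinarith
        refine ENNReal.ofReal_le_ofReal ?_
        linarith [hle a ha0]
  filter_upwards [measure_eq_zero_iff_ae_notMem.1 h0, measure_eq_zero_iff_ae_notMem.1 h1] with ω
    hω0 hω1
  exact ⟨hω0, hω1⟩

end Degenerate

lemma tsum_ofReal_mul_ofReal {T : ℕ → ℝ} (hT : ∀ n, 0 ≤ T n) {κ : ℝ} (hκ : 0 < κ)
    (hfin : ∑' n, ENNReal.ofReal κ * ENNReal.ofReal (T n) ≠ ⊤) :
    Summable T ∧ ∑' n, ENNReal.ofReal κ * ENNReal.ofReal (T n) = ENNReal.ofReal (κ * ∑' n, T n) := by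
  rw [ENNReal.tsum_mul_left] at hfin ⊢
  have h1 : ∑' n, ENNReal.ofReal (T n) ≠ ⊤ := fun h => by
    rw [h, ENNReal.mul_top (by simpa using hκ)] at hfin
    exact hfin rfl
  have h2 : Summable T := by
    simpa only [ENNReal.toReal_ofReal (hT _)] using ENNReal.summable_toReal h1
  exact ⟨h2, by rw [ENNReal.ofReal_mul hκ.le, ENNReal.ofReal_tsum_of_nonneg hT h2]⟩

section Pathwise

variable {Ω : Type*} {α P σ : ℝ} {X : ℕ → Ω → Plane} {h : ℕ → Ω → ℝ} {Z : Ω → Set ℕ} {ω : Ω}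

lemma interferenceTerm_nonneg (hh : ∀ n, 0 ≤ h n ω) (n : ℕ) :
    0 ≤ interferenceTerm α X h Z ω n :=
  Set.indicator_nonneg (fun n _ => mul_nonneg (hh n) (by positivity)) n

/-- Real-valued and extended interference, and the coverage condition expressed by either. -/
lemma interference_properties (hP : 0 < P) (hr : 0 < ‖X (serving X ω) ω‖) (hh : ∀ n, 0 ≤ h n ω)
    {S : ℝ≥0∞} (hS : S = ∑' n, ENNReal.ofReal (‖X (serving X ω) ω‖ ^ α) *
      ENNReal.ofReal (interferenceTerm α X h Z ω n)) (hS0 : S ≠ 0) (hSt : S ≠ ⊤) :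
    Summable (interferenceTerm α X h Z ω) ∧ 0 < σ ^ 2 + P * interference α X h Z ω ∧
      0 ≤ sinr P σ α X h Z ω ∧
      ∀ a, 0 ≤ a → (ENNReal.ofReal (a * (σ ^ 2 / P) * ‖X (serving X ω) ω‖ ^ α) + ENNReal.ofReal a * S
        ≤ ENNReal.ofReal (h (serving X ω) ω) ↔ a ≤ sinr P σ α X h Z ω) := by
  have hκ : 0 < ‖X (serving X ω) ω‖ ^ α := by positivity
  obtain ⟨h1, h2⟩ := tsum_ofReal_mul_ofReal (interferenceTerm_nonneg (Z := Z) (α := α) (X := X) hh) hκ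
    (by rwa [← hS])
  rw [← hS] at h2
  change S = ENNReal.ofReal (_ * interference α X h Z ω) at h2
  -- Positive interference keeps the denominator positive even without noise.
  have hpos : 0 < interference α X h Z ω := by
    rw [h2, Ne, ENNReal.ofReal_eq_zero, not_le] at hS0
    exact pos_of_mul_pos_right hS0 hκ.le
  have hD : 0 < σ ^ 2 + P * interference α X h Z ω := by positivity
  refine ⟨h1, hD, div_nonneg (mul_nonneg (mul_nonneg hP.le (hh _)) (by positivity)) hD.le,
    fun a ha => ?_⟩
  rw [h2, ← ENNReal.ofReal_mul ha, ← ENNReal.ofReal_add (by positivity) (by positivity),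
    ENNReal.ofReal_le_ofReal_iff (hh _), sinr, le_div_iff₀ hD, Real.rpow_neg hr.le,
    ← div_eq_mul_inv, le_div_iff₀ hκ]
  have : (a * (σ ^ 2 / P) * ‖X (serving X ω) ω‖ ^ α +
      a * (‖X (serving X ω) ω‖ ^ α * interference α X h Z ω)) * P
      = a * (σ ^ 2 + P * interference α X h Z ω) * ‖X (serving X ω) ω‖ ^ α := by
    field_simp
  rw [← this, mul_comm P, mul_le_mul_iff_left₀ hP]

lemma relPathLoss_mul_common {g : ℕ → Ω → ℝ} (hg : ∀ n, 0 ≤ g n ω) (n : ℕ) :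
    ENNReal.ofReal (relPathLoss α X ω n) * ENNReal.ofReal (g n ω)
      = ENNReal.ofReal (‖X (serving X ω) ω‖ ^ α) *
        ENNReal.ofReal (interferenceTerm α X g (commonInterferers X) ω n) := by
  unfold relPathLoss interferenceTerm
  by_cases hn : n = serving X ω
  · rw [Set.indicator_of_notMem (show n ∉ commonInterferers X ω from fun hc => hc hn)]
    simp [hn]
  · rw [Set.indicator_of_mem (show n ∈ commonInterferers X ω from hn), if_neg hn,
      ENNReal.ofReal_mul (by positivity), ENNReal.ofReal_mul (hg n)]
    ring

lemma relPathLoss_mul_edge {Δ : ℕ} {g' : ℕ → Ω → ℝ} {δ : ℕ → Ω → Fin Δ} (hg : ∀ n, 0 ≤ g' n ω)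
    (n : ℕ) :
    ENNReal.ofReal (relPathLoss α X ω n) *
        (if δ n ω = δ (serving X ω) ω then ENNReal.ofReal (g' n ω) else 0)
      = ENNReal.ofReal (‖X (serving X ω) ω‖ ^ α) *
        ENNReal.ofReal (interferenceTerm α X g' (edgeInterferers X δ) ω n) := by
  unfold relPathLoss interferenceTerm
  by_cases hn : n = serving X ω
  · rw [Set.indicator_of_notMem (show n ∉ edgeInterferers X δ ω from fun hc => hc.1 hn)]
    simp [hn]
  · by_cases hd : δ n ω = δ (serving X ω) ω
    · rw [Set.indicator_of_mem (show n ∈ edgeInterferers X δ ω from ⟨hn, hd⟩), if_neg hn, if_pos hd,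
        ENNReal.ofReal_mul (by positivity), ENNReal.ofReal_mul (hg n)]
      ring
    · rw [Set.indicator_of_notMem (show n ∉ edgeInterferers X δ ω from fun hc => hd hc.2), if_neg hd]
      simp

end Pathwise

lemma measurable_sinr {Ω : Type*} [MeasurableSpace Ω] {X : ℕ → Ω → Plane} {h : ℕ → Ω → ℝ}
    {Z : Ω → Set ℕ} (hX : ∀ n, Measurable (X n)) (hh : ∀ n, Measurable (h n))
    (hZ : ∀ n, MeasurableSet {ω | n ∈ Z ω}) (P σ α : ℝ) : Measurable (sinr P σ α X h Z) := by
  classical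
  have hs := measurable_serving hX
  have hI : Measurable (interference α X h Z) := by
    refine Measurable.tsum fun n => ?_
    simp only [interferenceTerm, Set.indicator_apply]
    exact Measurable.ite (hZ n) ((hh n).mul ((hX n).norm.pow_const _)) measurable_const
  exact (((measurable_apply_index hh hs).const_mul P).mul
    ((measurable_apply_index hX hs).norm.pow_const _)).div ((hI.const_mul P).const_add _)

section Network

variable {Ω : Type*} [MeasurableSpace Ω] {Pr : Measure Ω}
  {lam mu P σ α a b : ℝ} {Δ : ℕ} {X : ℕ → Ω → Plane} {g g' : ℕ → Ω → ℝ} {δ : ℕ → Ω → Fin Δ}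

lemma IsNetwork.measurable_sinr_common (h : IsNetwork Pr lam mu Δ X g g' δ) :
    Measurable (sinr P σ α X g (commonInterferers X)) :=
  measurable_sinr h.poisson.measurable h.measurable_fading (fun _ => (measurable_serving
    h.poisson.measurable (MeasurableSet.of_discrete (s := {k | _ ≠ k})))) P σ α

lemma IsNetwork.measurable_sinr_edge (h : IsNetwork Pr lam mu Δ X g g' δ) :
    Measurable (sinr P σ α X g' (edgeInterferers X δ)) := by
  have hs := measurable_serving h.poisson.measurable
  refine measurable_sinr h.poisson.measurable h.measurable_fading' (fun n => ?_) P σ α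
  refine MeasurableSet.inter (hs (MeasurableSet.of_discrete (s := {k | n ≠ k}))) ?_
  exact ((h.measurable_band n).prodMk (measurable_apply_index h.measurable_band hs))
    (MeasurableSet.of_discrete (s := {p : Fin Δ × Fin Δ | p.1 = p.2}))

lemma IsNetwork.ae_fading_nonneg (h : IsNetwork Pr lam mu Δ X g g' δ) (hmu : 0 < mu) (hΔ : 0 < Δ) :
    ∀ᵐ ω ∂Pr, ∀ n, 0 ≤ g n ω ∧ 0 ≤ g' n ω := by
  have := isProbabilityMeasure_expMeasure hmu
  refine ae_all_iff.2 fun n => ?_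
  have : NeZero Δ := ⟨hΔ.ne'⟩
  have h1 : markLaw mu Δ {m | m.1 < 0} = 0 := by
    have : {m : ℝ × ℝ × Fin Δ | m.1 < 0} = Set.Iio 0 ×ˢ Set.univ := by ext; simp
    rw [this, Measure.prod_prod, expMeasure_Iio_zero, zero_mul]
  have h2 : markLaw mu Δ {m | m.2.1 < 0} = 0 := by
    have : {m : ℝ × ℝ × Fin Δ | m.2.1 < 0} = Set.univ ×ˢ (Set.Iio 0 ×ˢ Set.univ) := by ext; simp
    rw [this, Measure.prod_prod, Measure.prod_prod, expMeasure_Iio_zero, zero_mul, mul_zero]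
  refine ((h.hasLaw_marks n).ae_iff (p := fun m => 0 ≤ m.1 ∧ 0 ≤ m.2.1) ?_).2 ?_
  · have h3 : MeasurableSet {m : ℝ × ℝ × Fin Δ | 0 ≤ m.1 ∧ 0 ≤ m.2.1} :=
      (measurableSet_le measurable_const measurable_fst).inter
        (measurableSet_le measurable_const measurable_snd.fst)
    exact measurableSet_setOfPred.1 h3
  · filter_upwards [measure_eq_zero_iff_ae_notMem.1 h1, measure_eq_zero_iff_ae_notMem.1 h2] with m
      hm1 hm2
    exact ⟨not_lt.1 hm1, not_lt.1 hm2⟩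

variable [IsProbabilityMeasure Pr]

/-- With zero noise and edge threshold `0`, coverage reduces to `a S ≤ G`, and its probability `1 /
(1 + 2 ξ)` is the tail required by `ae_ne_zero_and_ne_top_of_tail`. -/
lemma IsNetwork.ae_common_sum (h : IsNetwork Pr lam mu Δ X g g' δ) (hlam : 0 < lam) (hmu : 0 < mu)
    (hα : 2 < α) (hΔ : 0 < Δ) :
    ∀ᵐ ω ∂Pr, ∑' n, ENNReal.ofReal (relPathLoss α X ω n) * ENNReal.ofReal (g n ω) ≠ 0 ∧
      ∑' n, ENNReal.ofReal (relPathLoss α X ω n) * ENNReal.ofReal (g n ω) ≠ ⊤ := by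
  have hΔ' : (0 : ℝ) < Δ := by exact_mod_cast hΔ
  have hX := h.poisson.measurable
  refine ae_ne_zero_and_ne_top_of_tail (G := fun ω => ENNReal.ofReal (g (serving X ω) ω))
    (Q := fun a => xi 0 a α Δ) (β := 2 / α) (K := 4 * Δ) (Measurable.tsum fun n =>
      (measurable_relPathLoss hX n).ennreal_ofReal.mul (h.measurable_fading n).ennreal_ofReal)
    (measurable_apply_index h.measurable_fading (measurable_serving hX)).ennreal_ofReal
    (fun ω => ofReal_ne_top) (by positivity) (by positivity)
    (fun a ha => xi_nonneg ha.le le_rfl hΔ) (fun a ha => ?_)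
    (fun a ha => by simpa using xi_le ha.le le_rfl hα hΔ)
    (fun a ha => le_xi_of_one_le ha (zero_le_one.trans ha) le_rfl (Or.inl rfl) hα hΔ)
  rw [← qc_zero_noise (P := 1) (mu := mu) hlam ha.le le_rfl hΔ,
    ← h.measure_coveredEvent hlam hmu one_pos hα hΔ ha.le le_rfl]
  congr 1
  ext ω
  simp only [coveredEvent, Set.mem_ofPred_eq, ENNReal.ofReal_mul ha.le, mul_assoc, ENNReal.tsum_mul_left]
  simp

lemma IsNetwork.ae_edge_sum (h : IsNetwork Pr lam mu Δ X g g' δ) (hlam : 0 < lam) (hmu : 0 < mu)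
    (hα : 2 < α) (hΔ : 0 < Δ) :
    ∀ᵐ ω ∂Pr, ∑' n, ENNReal.ofReal (relPathLoss α X ω n) *
        (if δ n ω = δ (serving X ω) ω then ENNReal.ofReal (g' n ω) else 0) ≠ 0 ∧
      ∑' n, ENNReal.ofReal (relPathLoss α X ω n) *
        (if δ n ω = δ (serving X ω) ω then ENNReal.ofReal (g' n ω) else 0) ≠ ⊤ := by
  have hΔ' : (0 : ℝ) < Δ := by exact_mod_cast hΔ
  have hX := h.poisson.measurable
  have hite : ∀ n, Measurable fun ω =>
      if δ n ω = δ (serving X ω) ω then ENNReal.ofReal (g' n ω) else 0 := fun n =>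
    Measurable.ite (((h.measurable_band n).prodMk (measurable_apply_index h.measurable_band
      (measurable_serving hX))) (MeasurableSet.of_discrete (s := {p : Fin Δ × Fin Δ | p.1 = p.2})))
      (h.measurable_fading' n).ennreal_ofReal measurable_const
  refine ae_ne_zero_and_ne_top_of_tail (G := fun ω => ENNReal.ofReal (g' (serving X ω) ω))
    (Q := fun b => xi b 0 α Δ) (β := 2 / α) (K := 4 * Δ) (Measurable.tsum fun n =>
      (measurable_relPathLoss hX n).ennreal_ofReal.mul (hite n))
    (measurable_apply_index h.measurable_fading' (measurable_serving hX)).ennreal_ofReal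
    (fun ω => ofReal_ne_top) (by positivity) (by positivity)
    (fun b hb => xi_nonneg le_rfl hb.le hΔ) (fun b hb => ?_)
    (fun b hb => by simpa using xi_le le_rfl hb.le hα hΔ)
    (fun b hb => le_xi_of_one_le hb le_rfl (zero_le_one.trans hb) (Or.inr rfl) hα hΔ)
  rw [← qc_zero_noise (P := 1) (mu := mu) hlam le_rfl hb.le hΔ,
    ← h.measure_coveredEvent hlam hmu one_pos hα hΔ le_rfl hb.le]
  congr 1
  ext ω
  simp only [coveredEvent, Set.mem_ofPred_eq, ENNReal.ofReal_mul hb.le, mul_assoc, ENNReal.tsum_mul_left]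
  simp

/-- Almost surely the model is well defined, and coverage means that the ratios exceed the
thresholds. -/
theorem IsNetwork.ae_wellDefined (h : IsNetwork Pr lam mu Δ X g g' δ) (hlam : 0 < lam)
    (hmu : 0 < mu) (hP : 0 < P) (σ : ℝ) (hα : 2 < α) (hΔ : 0 < Δ) :
    ∀ᵐ ω ∂Pr, ((nearest X ω).Nonempty ∧
      Summable (interferenceTerm α X g (commonInterferers X) ω) ∧
      Summable (interferenceTerm α X g' (edgeInterferers X δ) ω) ∧
      0 < σ ^ 2 + P * interference α X g (commonInterferers X) ω ∧
      0 < σ ^ 2 + P * interference α X g' (edgeInterferers X δ) ω) ∧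
      0 ≤ sinr P σ α X g (commonInterferers X) ω ∧ 0 ≤ sinr P σ α X g' (edgeInterferers X δ) ω ∧
      ∀ a b, 0 ≤ a → 0 ≤ b → (ω ∈ coveredEvent (σ ^ 2 / P) α a b X g g' δ ↔
        a ≤ sinr P σ α X g (commonInterferers X) ω ∧
        b ≤ sinr P σ α X g' (edgeInterferers X δ) ω) := by
  filter_upwards [h.poisson.ae_nearest_nonempty, h.poisson.ae_norm_serving_pos hlam,
    h.ae_fading_nonneg hmu hΔ, h.ae_common_sum hlam hmu hα hΔ, h.ae_edge_sum hlam hmu hα hΔ]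
    with ω hne hr hg hc he
  obtain ⟨c1, c2, c3, c4⟩ := interference_properties (Z := commonInterferers X) (σ := σ) hP hr
    (fun n => (hg n).1) (tsum_congr fun n => relPathLoss_mul_common (fun n => (hg n).1) n) hc.1 hc.2
  obtain ⟨e1, e2, e3, e4⟩ := interference_properties (Z := edgeInterferers X δ) (σ := σ) hP hr
    (fun n => (hg n).2) (tsum_congr fun n => relPathLoss_mul_edge (fun n => (hg n).2) n) he.1 he.2
  refine ⟨⟨hne, c1, e1, c2, e2⟩, c3, e3, fun a b ha hb => ?_⟩
  rw [← c4 a ha, ← e4 b hb]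
  simp only [coveredEvent, Set.mem_ofPred_eq, ENNReal.ofReal_mul ha,
    ENNReal.ofReal_mul hb, mul_assoc, ENNReal.tsum_mul_left]

/-- The joint tail of the two signal to interference plus noise ratios. -/
theorem IsNetwork.measure_le_sinr (h : IsNetwork Pr lam mu Δ X g g' δ) (hlam : 0 < lam)
    (hmu : 0 < mu) (hP : 0 < P) (σ : ℝ) (hα : 2 < α) (hΔ : 0 < Δ) (ha : 0 ≤ a) (hb : 0 ≤ b) :
    Pr.real {ω | a ≤ sinr P σ α X g (commonInterferers X) ω ∧
      b ≤ sinr P σ α X g' (edgeInterferers X δ) ω} = qc P σ mu b a lam α Δ := by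
  rw [← ENNReal.toReal_ofReal (qc_nonneg (P := P) (σ := σ) (mu := mu) (a := a) (b := b) (α := α)
    (Δ := Δ) hlam), ← h.measure_coveredEvent hlam hmu hP hα hΔ ha hb]
  refine congrArg ENNReal.toReal (measure_congr ?_)
  filter_upwards [h.ae_wellDefined hlam hmu hP σ hα hΔ] with ω hω
  exact propext (hω.2.2.2 a b ha hb).symm

end Network

/-! ### Decay of the tail and the rate formula. -/

lemma qc_exp_sub_one_le {P σ mu lam α : ℝ} {Δ : ℕ} (hlam : 0 < lam) (hmu : 0 < mu) (hP : 0 < P)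
    (hα : 2 < α) (hΔ : 0 < Δ) {t : ℝ} (ht : 0 < t) :
    qc P σ mu (Real.exp t - 1) 0 lam α Δ
      ≤ 2 * Δ * (2 : ℝ) ^ (2 / α) * Real.exp (-(2 / α) * t) := by
  set c := Real.exp t - 1 with hc
  have hΔ' : (1 : ℝ) ≤ Δ := by exact_mod_cast hΔ
  have hc0 : 0 ≤ c := by
    have := Real.one_le_exp ht.le
    linarith
  have hβ : 0 < 2 / α := by positivity
  have hbound : 2 * Δ * (2 : ℝ) ^ (2 / α) * Real.exp (-(2 / α) * t)
      = 2 * Δ * (Real.exp t / 2) ^ (-(2 / α)) := by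
    rw [Real.div_rpow (Real.exp_pos t).le two_pos.le, ← Real.exp_mul, Real.rpow_neg two_pos.le,
      div_inv_eq_mul, mul_comm t]
    ring
  rw [hbound]
  refine (qc_le hlam hmu hP le_rfl hc0 hΔ).trans ?_
  have he : 0 < Real.exp t / 2 := by positivity
  -- If `c ≥ 1` then `c ≥ e ^ t / 2`, and the lower bound on `ξ` applies. If `c < 1` then `e ^ t / 2
  -- < 1`, so the claimed bound exceeds `1`.
  rcases le_or_gt 1 c with h1 | h1
  · have hxi := le_xi_of_one_le h1 le_rfl hc0 (Or.inr rfl) hα hΔ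
    have hcb : 0 < c ^ (2 / α) := by positivity
    have h3 : c ^ (2 / α) / (2 * Δ) ≤ 1 + 2 * xi c 0 α Δ := by
      have h4 : c ^ (2 / α) / (2 * Δ) = 2 * ((c ^ (2 / α) - 1) / (4 * Δ)) + 1 / (2 * Δ) := by
        field_simp; ring
      have h5 : 1 / (2 * (Δ : ℝ)) ≤ 1 := by rw [div_le_one (by positivity)]; linarith
      linarith
    calc 1 / (1 + 2 * xi c 0 α Δ) ≤ 1 / (c ^ (2 / α) / (2 * Δ)) :=
          one_div_le_one_div_of_le (by positivity) h3
      _ = 2 * Δ * c ^ (-(2 / α)) := by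
          rw [Real.rpow_neg hc0]; field_simp
      _ ≤ _ := by
          refine mul_le_mul_of_nonneg_left ?_ (by positivity)
          exact Real.rpow_le_rpow_of_nonpos he (by linarith) (by linarith)
  · have hxi : 0 ≤ xi c 0 α Δ := xi_nonneg le_rfl hc0 hΔ
    have h2 : 1 ≤ (Real.exp t / 2) ^ (-(2 / α)) :=
      Real.one_le_rpow_of_pos_of_le_one_of_nonpos he (by linarith) (by linarith)
    calc 1 / (1 + 2 * xi c 0 α Δ) ≤ 1 := by rw [div_le_one (by positivity)]; linarith
      _ ≤ 2 * Δ * (Real.exp t / 2) ^ (-(2 / α)) := by nlinarith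

end StrictFFR

theorem theorem5 {Ω : Type*} [MeasurableSpace Ω] (Pr : Measure Ω) [IsProbabilityMeasure Pr]
    (lam mu P σ α TFR : ℝ) (Δ : ℕ)
    (hlam : 0 < lam) (hmu : 0 < mu) (hP : 0 < P) (hα : 2 < α) (hTFR : 0 < TFR) (hΔ : 1 ≤ Δ)
    (X : ℕ → Ω → StrictFFR.Plane) (g g' : ℕ → Ω → ℝ) (δ : ℕ → Ω → Fin Δ)
    (hnet : StrictFFR.IsNetwork Pr lam mu Δ X g g' δ) :
    -- almost surely, the serving base station and the two SINRs are well defined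
    (∀ᵐ ω ∂Pr, (StrictFFR.nearest X ω).Nonempty ∧
      Summable (StrictFFR.interferenceTerm α X g (StrictFFR.commonInterferers X) ω) ∧
      Summable (StrictFFR.interferenceTerm α X g' (StrictFFR.edgeInterferers X δ) ω) ∧
      0 < σ ^ 2 + P * StrictFFR.interference α X g (StrictFFR.commonInterferers X) ω ∧
      0 < σ ^ 2 + P * StrictFFR.interference α X g' (StrictFFR.edgeInterferers X δ) ω) ∧
    -- the user is an edge user with positive probability
    0 < Pr (StrictFFR.edgeEvent P σ α TFR X g) ∧
    0 < 1 - StrictFFR.pc P σ mu TFR lam α 1 ∧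
    -- the average rate given that the user is an edge user
    Integrable (StrictFFR.edgeRate P σ α X g' δ)
      (ProbabilityTheory.cond Pr (StrictFFR.edgeEvent P σ α TFR X g)) ∧
    IntegrableOn (StrictFFR.rateIntegrand P σ mu TFR lam α Δ) (Set.Ioi 0) ∧
    ∫ ω, StrictFFR.edgeRate P σ α X g' δ ω
        ∂(ProbabilityTheory.cond Pr (StrictFFR.edgeEvent P σ α TFR X g)) =
      ∫ t in Set.Ioi (0 : ℝ), StrictFFR.rateIntegrand P σ mu TFR lam α Δ t := by
  open StrictFFR in
  have hae := hnet.ae_wellDefined hlam hmu hP σ hα hΔ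
  have hjoint := fun (a b : ℝ) (ha : 0 ≤ a) (hb : 0 ≤ b) =>
    hnet.measure_le_sinr hlam hmu hP σ hα hΔ ha hb
  have hm1 : Measurable (sinr P σ α X g (commonInterferers X)) := hnet.measurable_sinr_common
  have hm2 : Measurable (sinr P σ α X g' (edgeInterferers X δ)) := hnet.measurable_sinr_edge
  set S1 := sinr P σ α X g (commonInterferers X) with hS1
  set S2 := sinr P σ α X g' (edgeInterferers X δ) with hS2
  set A := edgeEvent P σ α TFR X g with hA
  have hAm : MeasurableSet A := measurableSet_lt hm1 measurable_const
  have hpc : pc P σ mu TFR lam α 1 = qc P σ mu 0 TFR lam α Δ :=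
    pc_one_eq_qc_common hTFR hα P σ mu lam Δ
  -- the probability of the edge event
  have hAcap : ∀ b, 0 ≤ b → Pr.real (A ∩ {ω | b ≤ S2 ω})
      = qc P σ mu b 0 lam α Δ - qc P σ mu b TFR lam α Δ := fun b hb => by
    have hBm : MeasurableSet {ω | b ≤ S2 ω} := measurableSet_le measurable_const hm2
    have h1 : Pr.real {ω | b ≤ S2 ω} = qc P σ mu b 0 lam α Δ := by
      rw [← hjoint 0 b le_rfl hb]
      refine congrArg ENNReal.toReal (measure_congr ?_)
      filter_upwards [hae] with ω hω
      exact propext ⟨fun h => ⟨hω.2.1, h⟩, fun h => h.2⟩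
    -- Outside the edge event both thresholds are met, so the joint tail is what has to be
    -- subtracted from the marginal.
    have h2 : {ω | b ≤ S2 ω} \ A = {ω | TFR ≤ S1 ω ∧ b ≤ S2 ω} := by
      ext ω
      constructor
      · exact fun h => ⟨not_lt.1 h.2, h.1⟩
      · exact fun h => ⟨h.2, not_lt.2 h.1⟩
    have h3 := measureReal_inter_add_sdiff (μ := Pr) (s := {ω | b ≤ S2 ω}) hAm
    rw [h1, h2, hjoint TFR b hTFR.le hb] at h3
    rw [Set.inter_comm]
    linarith
  have hPA : Pr.real A = 1 - pc P σ mu TFR lam α 1 := by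
    have h1 : Pr.real Aᶜ = qc P σ mu 0 TFR lam α Δ := by
      rw [← hjoint TFR 0 hTFR.le le_rfl]
      refine congrArg ENNReal.toReal (measure_congr ?_)
      filter_upwards [hae] with ω hω
      exact propext ⟨fun h => ⟨not_lt.1 h, hω.2.2.1⟩, fun h => not_lt.2 h.1⟩
    rw [probReal_compl_eq_one_sub hAm] at h1
    rw [hpc]
    linarith
  have hpos : 0 < 1 - pc P σ mu TFR lam α 1 := by
    have hxi := xi_pos hTFR le_rfl hα (show 0 < Δ from hΔ) (b := 0)
    have h1 := qc_le (σ := σ) (α := α) hlam hmu hP hTFR.le le_rfl (show 0 < Δ from hΔ) (b := 0)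
    have h2 : 1 / (1 + 2 * xi 0 TFR α Δ) < 1 := by
      rw [div_lt_one (by positivity)]
      linarith
    rw [hpc]
    linarith
  have hPA0 : 0 < Pr A := by
    rw [← hPA] at hpos
    exact (ENNReal.toReal_pos_iff.1 hpos).1
  set κ := ProbabilityTheory.cond Pr A with hκ
  have : IsProbabilityMeasure κ := cond_isProbabilityMeasure hPA0.ne'
  have haeκ := (cond_absolutelyContinuous (μ := Pr) (s := A)).ae_le hae
  -- the tail of the rate
  have htail : ∀ t ∈ Set.Ioi (0 : ℝ), κ.real {ω | t ≤ edgeRate P σ α X g' δ ω}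
      = rateIntegrand P σ mu TFR lam α Δ t := by
    intro t (ht : 0 < t)
    have hT : 0 < Real.exp t - 1 := by
      have := Real.add_one_lt_exp ht.ne'
      linarith
    have h1 : κ {ω | t ≤ edgeRate P σ α X g' δ ω} = κ {ω | Real.exp t - 1 ≤ S2 ω} := by
      refine measure_congr ?_
      filter_upwards [haeκ] with ω hω
      have h2 : 0 ≤ S2 ω := hω.2.2.1
      refine propext ?_
      change t ≤ Real.log (1 + S2 ω) ↔ Real.exp t - 1 ≤ S2 ω
      rw [Real.le_log_iff_exp_le (by linarith)]
      constructor <;> intro <;> linarith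
    rw [Measure.real, h1, hκ, cond_apply hAm, ENNReal.toReal_mul, ENNReal.toReal_inv]
    change (Pr.real A)⁻¹ * Pr.real (A ∩ _) = _
    rw [hPA, hAcap _ hT.le, rateIntegrand, pc_eq_qc_edge hT hα, inv_mul_eq_div]
  have hrate : 0 ≤ᵐ[κ] edgeRate P σ α X g' δ := by
    filter_upwards [haeκ] with ω hω
    have h2 : 0 ≤ S2 ω := hω.2.2.1
    exact Real.log_nonneg (by change 1 ≤ 1 + S2 ω; linarith)
  have hratem : Measurable (edgeRate P σ α X g' δ) := Real.measurable_log.comp (hm2.const_add 1)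
  -- Monotonicity supplies the measurability of the tail in `t`.
  have hanti : Antitone fun t : ℝ => κ.real {ω | t ≤ edgeRate P σ α X g' δ ω} := fun s t hst =>
    measureReal_mono fun ω hω => hst.trans hω
  have hint' : IntegrableOn (fun t : ℝ => κ.real {ω | t ≤ edgeRate P σ α X g' δ ω}) (Set.Ioi 0) := by
    refine Integrable.mono' (g := fun t => (1 - pc P σ mu TFR lam α 1)⁻¹ *
      (2 * Δ * (2 : ℝ) ^ (2 / α) * Real.exp (-(2 / α) * t))) ?_
      hanti.measurable.aestronglyMeasurable ?_
    · have hβ : 0 < 2 / α := by positivity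
      exact ((integrableOn_exp_mul_Ioi (neg_lt_zero.2 hβ) 0).const_mul _).const_mul _
    · refine (ae_restrict_mem measurableSet_Ioi).mono fun t (ht : 0 < t) => ?_
      have hT : 0 < Real.exp t - 1 := by
        have := Real.add_one_lt_exp ht.ne'
        linarith
      rw [Real.norm_of_nonneg measureReal_nonneg, htail t ht, rateIntegrand, pc_eq_qc_edge hT hα,
        div_eq_inv_mul]
      refine mul_le_mul_of_nonneg_left ?_ (inv_nonneg.2 hpos.le)
      have h1 := qc_exp_sub_one_le (σ := σ) (P := P) (mu := mu) hlam hmu hP hα (show 0 < Δ from hΔ) ht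
      have h2 : 0 ≤ qc P σ mu (Real.exp t - 1) TFR lam α Δ := qc_nonneg hlam
      linarith
  have hint : Integrable (edgeRate P σ α X g' δ) κ := by
    -- The layer cake formula in `[0, ∞]` reduces integrability of the rate to that of its tail.
    rw [← lintegral_ofReal_ne_top_iff_integrable hratem.aestronglyMeasurable hrate,
      lintegral_eq_lintegral_meas_le κ hrate hratem.aemeasurable]
    have h1 := (lintegral_ofReal_ne_top_iff_integrable hint'.aestronglyMeasurable
      (Filter.Eventually.of_forall fun t => measureReal_nonneg)).2 hint'
    rwa [lintegral_congr fun t => ofReal_measureReal (measure_ne_top κ _)] at h1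
  refine ⟨hae.mono fun ω hω => hω.1, hPA0, hpos, hint,
    hint'.congr_fun htail measurableSet_Ioi, ?_⟩
  rw [hint.integral_eq_integral_meas_le hrate]
  exact setIntegral_congr_fun measurableSet_Ioi htail
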